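/- Let $X$ be a proper $\mathrm{CAT}(0)$-space with visual boundary $\partial X$, and let $\mathrm{Iso}(X)$ be its isometry group, equipped with the compact-open topology. For a subgroup $G<\mathrm{Iso}(X)$ let $\Lambda\subset\partial X$ be its limit set, that is, the set of accumulation points in $\partial X$ of an orbit of $G$ on $X$, where $X\cup\partial X$ carries the cone topology. Call $G$ non-elementary if $\Lambda$ contains at least three points and $G$ does not globally fix a point of $\partial X$. Call an isometry $g$ of $X$ rank-one if its displacement function $x\mapsto d(x,gx)$ assumes a positive minimum and if for some $B>0$ there is an axis $\gamma:\mathbb{R}\to X$ of $g$ (a geodesic line which $g$ translates by this minimum) which is $B$-contracting: for every closed metric ball $K\subset X$ disjoint from $\gamma(\mathbb{R})$, the shortest distance projection of $K$ to $\gamma(\mathbb{R})$ has diameter at most $B$. Let $G<\mathrm{Iso}(X)$ be a closed non-elementary subgroup with limit set $\Lambda$, and let $g\in G$ be a rank-one element with fixed points $a\neq b\in\Lambda$. If $G$ does not act transitively on the complement of the diagonal in $\Lambda\times\Lambda$, then there is some $h\in G$ such that the stabilizer in $G$ of the pair $(b,hb)\in\Lambda\times\Lambda$ is compact. -/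

import Mathlib

open Set Metric Topology
open scoped NNReal

namespace RankOne

universe u

/-- `γ` restricted to `J ⊆ ℝ` is a geodesic parametrised by arc length. -/
def IsGeodesicOn {X : Type u} [MetricSpace X] (γ : ℝ → X) (J : Set ℝ) : Prop :=
  ∀ s ∈ J, ∀ t ∈ J, dist (γ s) (γ t) = |s - t|

/-- A `CAT(0)` space: any two points are joined by a geodesic, and geodesic triangles are not
thicker than their comparison triangles `p, q, r` in the Euclidean plane. The triangle has the
vertices `α 0 = β 0`, `α a`, `β b` and the sides `α`, `β` (and any geodesic from `α a` to `β b`).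
As every vertex may play the role of `α 0`, all pairs of points on two sides are compared. -/
structure IsCAT0 (X : Type u) [MetricSpace X] : Prop where
  exists_geodesic : ∀ x y : X, ∃ γ : ℝ → X,
    IsGeodesicOn γ (Icc 0 (dist x y)) ∧ γ 0 = x ∧ γ (dist x y) = y
  comparison : ∀ (α β : ℝ → X) (a b : ℝ), 0 ≤ a → 0 ≤ b →
    IsGeodesicOn α (Icc 0 a) → IsGeodesicOn β (Icc 0 b) → α 0 = β 0 →
    ∀ p q r : EuclideanSpace ℝ (Fin 2),
      dist p q = a → dist p r = b → dist q r = dist (α a) (β b) →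
      ∀ s ∈ Icc (0 : ℝ) 1, ∀ t ∈ Icc (0 : ℝ) 1,
        dist (α (s * a)) (β (t * b)) ≤ dist (AffineMap.lineMap p q s) (AffineMap.lineMap p r t)

/-! ### The visual boundary -/

/-- Geodesic rays `[0, ∞) → X`. -/
structure Ray (X : Type u) [MetricSpace X] where
  toFun : ℝ≥0 → X
  isometry' : Isometry toFun

/-- Two rays are asymptotic if they stay at bounded distance from each other. -/
instance raySetoid (X : Type u) [MetricSpace X] : Setoid (Ray X) where
  r c c' := ∃ C : ℝ, ∀ t, dist (c.toFun t) (c'.toFun t) ≤ C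
  iseqv :=
    { refl := fun c => ⟨0, fun t => by simp⟩
      symm := fun ⟨C, h⟩ => ⟨C, fun t => by rw [dist_comm]; exact h t⟩
      trans := fun ⟨C, h⟩ ⟨D, k⟩ =>
        ⟨C + D, fun t => (dist_triangle _ _ _).trans (add_le_add (h t) (k t))⟩ }

/-- The visual boundary `∂X`: asymptoty classes of geodesic rays. -/
def Boundary (X : Type u) [MetricSpace X] : Type u := Quotient (raySetoid X)

/-- The endpoint `c(∞) ∈ ∂X` of a ray. -/
def Ray.endpoint {X : Type u} [MetricSpace X] (c : Ray X) : Boundary X :=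
  Quotient.mk (raySetoid X) c

/-- The image of a ray under an isometry. -/
def Ray.map {X : Type u} [MetricSpace X] (g : X ≃ᵢ X) (c : Ray X) : Ray X :=
  ⟨fun t => g (c.toFun t), g.isometry.comp c.isometry'⟩

/-- The action of the isometry group on the boundary, `g • c(∞) = (g ∘ c)(∞)`. -/
instance boundaryMulAction (X : Type u) [MetricSpace X] : MulAction (X ≃ᵢ X) (Boundary X) where
  smul g := Quotient.map (Ray.map g) (fun _ _ ⟨C, h⟩ =>
    ⟨C, fun t => by simpa [Ray.map, g.isometry.dist_eq] using h t⟩)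
  one_smul ξ := by
    induction ξ using Quotient.inductionOn
    rfl
  mul_smul g h ξ := by
    induction ξ using Quotient.inductionOn
    rfl

/-- The space `X ∪ ∂X`. -/
inductive Bordification (X : Type u) [MetricSpace X] : Type u
  | inner (x : X) : Bordification X
  | ideal (ξ : Boundary X) : Bordification X

/-- The set of all `z ∈ X ∪ ∂X` at distance more than `r` from `c(0)` for which the geodesic from
`c(0)` to `z` is at the time `r` at distance less than `ε` from `c(r)`. -/
def coneNhd {X : Type u} [MetricSpace X] (c : Ray X) (r : ℝ≥0) (ε : ℝ) : Set (Bordification X) :=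
  {z | (∃ x p : X, z = .inner x ∧ (r : ℝ) < dist (c.toFun 0) x ∧ dist (c.toFun 0) p = r ∧
          dist p x = dist (c.toFun 0) x - r ∧ dist p (c.toFun r) < ε) ∨
       (∃ c' : Ray X, z = .ideal c'.endpoint ∧ c'.toFun 0 = c.toFun 0 ∧
          dist (c'.toFun r) (c.toFun r) < ε)}

/-- The cone topology on `X ∪ ∂X`: it is generated by the open balls of `X` and the sets
`coneNhd c r ε`. -/
instance coneTopology (X : Type u) [MetricSpace X] : TopologicalSpace (Bordification X) :=
  TopologicalSpace.generateFrom
    ({U | ∃ (x : X) (r : ℝ), U = Bordification.inner '' ball x r} ∪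
     {U | ∃ (c : Ray X) (r : ℝ≥0) (ε : ℝ), 0 < r ∧ 0 < ε ∧ U = coneNhd c r ε})

/-! ### Groups of isometries -/

/-- The compact-open topology on the isometry group. -/
instance isoTopology (X : Type u) [MetricSpace X] : TopologicalSpace (X ≃ᵢ X) :=
  TopologicalSpace.induced (fun g => (⟨g, g.continuous⟩ : C(X, X))) inferInstance

/-- The limit set of `G`: the accumulation points in `∂X` of an orbit of `G` in `X`. -/
def limitSet {X : Type u} [MetricSpace X] (G : Subgroup (X ≃ᵢ X)) : Set (Boundary X) :=
  {ξ | ∃ x : X, AccPt (Bordification.ideal ξ)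
    (Filter.principal {z | ∃ g ∈ G, z = Bordification.inner (g x)})}

/-- `G` is non-elementary: its limit set has at least three points and `G` has no global fixed
point in `∂X`. -/
def IsNonelementary {X : Type u} [MetricSpace X] (G : Subgroup (X ≃ᵢ X)) : Prop :=
  3 ≤ (limitSet G).encard ∧ ¬ ∃ ξ : Boundary X, ∀ g ∈ G, g • ξ = ξ

/-! ### Rank-one isometries -/

/-- `p` is a point of `L` of smallest distance to `x`. -/
def IsProjection {X : Type u} [MetricSpace X] (L : Set X) (x p : X) : Prop :=
  p ∈ L ∧ ∀ q ∈ L, dist x p ≤ dist x q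

/-- The shortest distance projection to `L` of every closed ball disjoint from `L` has diameter at
most `B`. -/
def IsContracting {X : Type u} [MetricSpace X] (B : ℝ) (L : Set X) : Prop :=
  ∀ (x : X) (r : ℝ), Disjoint (closedBall x r) L →
    ∀ y ∈ closedBall x r, ∀ z ∈ closedBall x r, ∀ p q : X,
      IsProjection L y p → IsProjection L z q → dist p q ≤ B

/-- An isometry is axial if its displacement function assumes a minimum and this minimum is
positive. -/
def IsAxial {X : Type u} [MetricSpace X] (g : X ≃ᵢ X) : Prop :=
  ∃ τ : ℝ, IsLeast (range fun x => dist x (g x)) τ ∧ 0 < τ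

/-- The geodesic line `γ` is an oriented axis of `g`: the isometry `g` acts on it as the
translation by the minimum `τ` of the displacement function, and `τ` is positive. -/
def IsAxis {X : Type u} [MetricSpace X] (g : X ≃ᵢ X) (γ : ℝ → X) : Prop :=
  Isometry γ ∧ ∃ τ : ℝ, IsLeast (range fun x => dist x (g x)) τ ∧ 0 < τ ∧
    ∀ t, g (γ t) = γ (t + τ)

/-- A rank-one isometry: an axial isometry with an axis that is `B`-contracting for a `B > 0`. -/
def IsRankOne {X : Type u} [MetricSpace X] (g : X ≃ᵢ X) : Prop :=
  IsAxial g ∧ ∃ B : ℝ, 0 < B ∧ ∃ γ : ℝ → X, IsAxis g γ ∧ IsContracting B (range γ)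

end RankOne

/-! Suppose that all stabilizers of pairs (b, hb) are non-compact. If hb ≠ b, the contracting axis γ
of g yields a line ρ from hb to b. The stabilizer translates ρ up to an error 8 * B, and by
non-compactness by arbitrarily large amounts. Pushing γ far towards b with a power of g and pulling
it back along ρ with a stabilizer element keeps it near ρ; a limit of these products lies in the
closed group G, fixes b and maps a to hb (`IsCAT0.exists_smul_eq_of_not_isCompact`). As G does not
fix b, this puts a into the orbit O of b, and G is transitive on pairs of distinct points of O.

Contradiction arises once Λ ⊆ O. If orbit points f n x converge to ξ ∈ Λ, pair transitivity gives
translates of γ passing near γ 0 and afterwards near f n (γ 0) (`IsCAT0.exists_translate`). The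
translating elements move γ 0 by a bounded amount, hence converge along an ultrafilter, and the
limit maps b to ξ (`IsCAT0.exists_smul_eq_of_mem_limitSet`).

The geometric input is `IsProjectionMap.exists_dist_le`: away from a contracting set projections
move slowly, so a geodesic whose ends project far apart must approach the set. Convexity of the
metric spreads closeness at endpoints over whole segments. -/

namespace RankOne

universe u

variable {X : Type u} [MetricSpace X]

/-! ### Convexity of the distance in `CAT(0)` spaces -/

theorem exists_comparison_triangle {a b c : ℝ} (ha : 0 ≤ a) (hb : 0 ≤ b) (hc : 0 ≤ c)
    (hab : c ≤ a + b) (hbc : a ≤ b + c) (hac : b ≤ a + c) :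
    ∃ p q r : EuclideanSpace ℝ (Fin 2), dist p q = a ∧ dist p r = b ∧ dist q r = c := by
  rcases ha.eq_or_lt with rfl | ha'
  · have hcb : c = b := by linarith
    subst hcb
    refine ⟨!₂[0, 0], !₂[0, 0], !₂[c, 0], ?_, ?_, ?_⟩ <;>
      simp [EuclideanSpace.dist_eq, Real.dist_eq, Real.sqrt_sq_eq_abs, abs_of_nonneg hc]
  -- Law of cosines: u is the first coordinate of r when p is the origin and q = (a, 0).
  · set u : ℝ := (a ^ 2 + b ^ 2 - c ^ 2) / (2 * a) with hu
    have hua : u * (2 * a) = a ^ 2 + b ^ 2 - c ^ 2 := by rw [hu]; field_simp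
    have hu1 : u ≤ b := by
      rw [hu, div_le_iff₀ (by positivity)]
      nlinarith
    have hu2 : -b ≤ u := by
      rw [hu, le_div_iff₀ (by positivity)]
      nlinarith
    have hv : 0 ≤ b ^ 2 - u ^ 2 := by nlinarith
    refine ⟨!₂[0, 0], !₂[a, 0], !₂[u, √(b ^ 2 - u ^ 2)], ?_, ?_, ?_⟩
    · simp [EuclideanSpace.dist_eq, Real.dist_eq, Real.sqrt_sq_eq_abs, abs_of_nonneg ha]
    · simp [EuclideanSpace.dist_eq, Real.dist_eq, Real.sq_sqrt hv, Real.sqrt_sq_eq_abs,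
        abs_of_nonneg hb]
    · have : (a - u) ^ 2 + (b ^ 2 - u ^ 2) = c ^ 2 := by nlinarith
      simp [EuclideanSpace.dist_eq, Real.dist_eq, Real.sq_sqrt hv, this, Real.sqrt_sq_eq_abs,
        abs_of_nonneg hc]

theorem IsGeodesicOn.mono {γ : ℝ → X} {J K : Set ℝ} (h : IsGeodesicOn γ K) (hJ : J ⊆ K) :
    IsGeodesicOn γ J := fun s hs t ht => h s (hJ hs) t (hJ ht)

theorem IsGeodesicOn.of_isometry {γ : ℝ → X} (h : Isometry γ) (J : Set ℝ) : IsGeodesicOn γ J :=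
  fun s _ t _ => by rw [h.dist_eq, Real.dist_eq]

theorem IsGeodesicOn.comp_add {γ : ℝ → X} {J K : Set ℝ} (h : IsGeodesicOn γ K) (c : ℝ)
    (hJ : ∀ t ∈ J, c + t ∈ K) : IsGeodesicOn (fun t => γ (c + t)) J := fun s hs t ht => by
  rw [h _ (hJ s hs) _ (hJ t ht)]; congr 1; ring

theorem IsGeodesicOn.comp_sub {γ : ℝ → X} {J K : Set ℝ} (h : IsGeodesicOn γ K) (c : ℝ)
    (hJ : ∀ t ∈ J, c - t ∈ K) : IsGeodesicOn (fun t => γ (c - t)) J := fun s hs t ht => by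
  rw [h _ (hJ s hs) _ (hJ t ht), ← abs_neg]; congr 1; ring

/-- For equal ratios l on both sides the comparison distance in the plane is exactly l times the
third side. -/
theorem IsCAT0.dist_le_of_common_start (hX : IsCAT0 X) {α β : ℝ → X} {a b : ℝ} (ha : 0 ≤ a)
    (hb : 0 ≤ b) (hα : IsGeodesicOn α (Icc 0 a)) (hβ : IsGeodesicOn β (Icc 0 b))
    (h0 : α 0 = β 0) {l : ℝ} (hl : l ∈ Icc (0 : ℝ) 1) :
    dist (α (l * a)) (β (l * b)) ≤ l * dist (α a) (β b) := by
  have h1 : dist (α 0) (α a) = a := by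
    rw [hα 0 ⟨le_rfl, ha⟩ a ⟨ha, le_rfl⟩, zero_sub, abs_neg, abs_of_nonneg ha]
  have h2 : dist (α 0) (β b) = b := by
    rw [h0, hβ 0 ⟨le_rfl, hb⟩ b ⟨hb, le_rfl⟩, zero_sub, abs_neg, abs_of_nonneg hb]
  obtain ⟨p, q, r, hpq, hpr, hqr⟩ := exists_comparison_triangle ha hb
    (dist_nonneg (x := α a) (y := β b))
    (by have := dist_triangle_left (α a) (β b) (α 0); linarith)
    (by have := dist_triangle_right (α 0) (α a) (β b); linarith)
    (by have := dist_triangle (α 0) (α a) (β b); linarith)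
  refine (hX.comparison α β a b ha hb hα hβ h0 p q r hpq hpr hqr l hl l hl).trans ?_
  rw [← hqr, dist_eq_norm, dist_eq_norm, AffineMap.lineMap_apply, AffineMap.lineMap_apply]
  simp only [vsub_eq_sub, vadd_eq_add]
  have : l • (q - p) + p - (l • (r - p) + p) = l • (q - r) := by module
  rw [this, norm_smul, Real.norm_of_nonneg hl.1]

/-- The distance between two geodesics, parametrised proportionally to arc length, is convex. -/
theorem IsCAT0.dist_convex (hX : IsCAT0 X) {α β : ℝ → X} {a a' b b' : ℝ} (ha : a ≤ a')
    (hb : b ≤ b') (hα : IsGeodesicOn α (Icc a a')) (hβ : IsGeodesicOn β (Icc b b'))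
    {l : ℝ} (hl : l ∈ Icc (0 : ℝ) 1) :
    dist (α (a + l * (a' - a))) (β (b + l * (b' - b))) ≤
      (1 - l) * dist (α a) (β b) + l * dist (α a') (β b') := by
  -- The diagonal δ cuts the quadrilateral into two triangles; the second is read backwards from the
  -- vertex β b', hence with ratio 1 - l.
  obtain ⟨δ, hδ, hδ0, hδ1⟩ := hX.exists_geodesic (α a) (β b')
  set L := dist (α a) (β b')
  have hL : 0 ≤ L := dist_nonneg
  have h1 := hX.dist_le_of_common_start (α := fun t => α (a + t)) (β := δ) (sub_nonneg.2 ha) hL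
    (hα.comp_add a fun t ht => ⟨by linarith [ht.1], by linarith [ht.2]⟩) hδ (by simp [hδ0]) hl
  have h2 := hX.dist_le_of_common_start (α := fun t => δ (L - t)) (β := fun t => β (b' - t)) hL
    (sub_nonneg.2 hb) (hδ.comp_sub L fun t ht => ⟨by linarith [ht.2], by linarith [ht.1]⟩)
    (hβ.comp_sub b' fun t ht => ⟨by linarith [ht.2], by linarith [ht.1]⟩) (by simp [hδ1])
    (l := 1 - l) ⟨by linarith [hl.2], by linarith [hl.1]⟩
  simp only [add_sub_cancel, sub_self, sub_sub_cancel, hδ0, hδ1] at h1 h2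
  have e1 : L - (1 - l) * L = l * L := by ring
  have e2 : b' - (1 - l) * (b' - b) = b + l * (b' - b) := by ring
  rw [e1, e2] at h2
  have := dist_triangle (α (a + l * (a' - a))) (δ (l * L)) (β (b + l * (b' - b)))
  linarith

/-- Two geodesics whose endpoints are close fellow travel, also when parametrised by arc length. -/
theorem IsCAT0.fellow_travel (hX : IsCAT0 X) {α β : ℝ → X} {a b C D t : ℝ}
    (hα : IsGeodesicOn α (Icc 0 a)) (hβ : IsGeodesicOn β (Icc 0 b))
    (h0 : dist (α 0) (β 0) ≤ C) (h1 : dist (α a) (β b) ≤ D)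
    (ht : 0 ≤ t) (hta : t ≤ a) (htb : t ≤ b) : dist (α t) (β t) ≤ 2 * (C + D) := by
  have hC : 0 ≤ C := dist_nonneg.trans h0
  have hD : 0 ≤ D := dist_nonneg.trans h1
  rcases ht.eq_or_lt with rfl | ht'
  · linarith
  have ha : 0 < a := by linarith
  have hb : 0 < b := by linarith
  -- At ratio l, α is at time t but β at time l * b, which differs from t by at most |a - b| ≤ C +
  -- D.
  set l := t / a
  have hl : l ∈ Icc (0 : ℝ) 1 := ⟨by positivity, (div_le_one ha).2 hta⟩
  have hla : l * a = t := by simp [l, ha.ne']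
  have h2 := hX.dist_convex ha.le hb.le hα hβ hl
  simp only [sub_zero, zero_add, hla] at h2
  have hlb : l * b ∈ Icc 0 b := ⟨mul_nonneg hl.1 hb.le, by nlinarith [hl.2]⟩
  have h3 := hβ (l * b) hlb t ⟨ht, htb⟩
  have h4 : |a - b| ≤ C + D := by
    have e1 := hα 0 ⟨le_rfl, ha.le⟩ a ⟨ha.le, le_rfl⟩
    have e2 := hβ 0 ⟨le_rfl, hb.le⟩ b ⟨hb.le, le_rfl⟩
    simp only [zero_sub, abs_neg, abs_of_pos ha, abs_of_pos hb] at e1 e2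
    rw [← e1, ← e2, ← Real.dist_eq]
    exact (dist_dist_dist_le _ _ _ _).trans (add_le_add h0 h1)
  have h5 : |l * b - t| ≤ C + D := by
    rw [← hla, ← mul_sub, abs_mul, abs_of_nonneg hl.1, abs_sub_comm]
    nlinarith [hl.2, abs_nonneg (a - b)]
  have h6 := dist_triangle (α t) (β (l * b)) (β t)
  nlinarith [hl.1, hl.2]

/-- The distance between two asymptotic rays does not increase. -/
theorem IsCAT0.dist_le_of_bounded (hX : IsCAT0 X) {α β : ℝ → X} {a C t : ℝ}
    (hα : IsGeodesicOn α (Ici a)) (hβ : IsGeodesicOn β (Ici a))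
    (hC : ∀ t, a ≤ t → dist (α t) (β t) ≤ C) (ht : a ≤ t) :
    dist (α t) (β t) ≤ dist (α a) (β a) := by
  have hC0 : 0 ≤ C := dist_nonneg.trans (hC a le_rfl)
  refine le_of_forall_pos_le_add fun ε hε => ?_
  -- On [a, a + d] the time t has ratio (t - a) / d, so small that the far end contributes at most
  -- ε.
  set d := (t - a) * (C / ε) + (t - a) + 1
  have hta : 0 ≤ t - a := sub_nonneg.2 ht
  have hd' : 0 ≤ (t - a) * (C / ε) := by positivity
  have hd : 0 < d := by positivity
  have hl : (t - a) / d ∈ Icc (0 : ℝ) 1 := ⟨by positivity, by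
    rw [div_le_one hd]; simp only [d]; linarith⟩
  have h := hX.dist_convex (a := a) (a' := a + d) (b := a) (b' := a + d) (by linarith)
    (by linarith) (hα.mono fun s hs => hs.1) (hβ.mono fun s hs => hs.1) hl
  have e : a + (t - a) / d * (a + d - a) = t := by field_simp; ring
  rw [e] at h
  have h1 : (t - a) / d * dist (α (a + d)) (β (a + d)) ≤ ε := by
    refine (mul_le_mul_of_nonneg_left (hC (a + d) (by linarith)) hl.1).trans ?_
    rw [div_mul_eq_mul_div, div_le_iff₀ hd]
    have : (t - a) * C = ε * ((t - a) * (C / ε)) := by field_simp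
    rw [this]
    exact mul_le_mul_of_nonneg_left (by simp only [d]; linarith) hε.le
  nlinarith [hl.1, dist_nonneg (x := α a) (y := β a)]

/-- Geodesics from `x` to `p` and from `p` to `y` concatenate if `p` lies between `x` and `y`. -/
theorem IsCAT0.exists_geodesic_through (hX : IsCAT0 X) {x p y : X}
    (h : dist x p + dist p y = dist x y) : ∃ δ : ℝ → X,
      IsGeodesicOn δ (Icc 0 (dist x y)) ∧ δ 0 = x ∧ δ (dist x p) = p ∧ δ (dist x y) = y := by
  obtain ⟨α, hα, hα0, hα1⟩ := hX.exists_geodesic x p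
  obtain ⟨β, hβ, hβ0, hβ1⟩ := hX.exists_geodesic p y
  have hxp := dist_nonneg (x := x) (y := p)
  have hpy := dist_nonneg (x := p) (y := y)
  -- A shortcut between the two pieces would make x and y closer than dist x y.
  have key : ∀ s ∈ Icc 0 (dist x p), ∀ t ∈ Icc 0 (dist p y),
      dist (α s) (β t) = t + dist x p - s := fun s hs t ht => by
    have e1 := hα s hs _ ⟨hxp, le_rfl⟩
    have e2 := hβ 0 ⟨le_rfl, hpy⟩ t ht
    have e3 := hα 0 ⟨le_rfl, hxp⟩ s hs
    have e4 := hβ t ht _ ⟨hpy, le_rfl⟩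
    rw [hα1, abs_sub_comm, abs_of_nonneg (by linarith [hs.2])] at e1
    rw [hβ0, zero_sub, abs_neg, abs_of_nonneg ht.1] at e2
    rw [hα0, zero_sub, abs_neg, abs_of_nonneg hs.1] at e3
    rw [hβ1, abs_sub_comm, abs_of_nonneg (by linarith [ht.2])] at e4
    have f1 := dist_triangle (α s) p (β t)
    have f2 := dist_triangle4 x (α s) (β t) y
    linarith
  refine ⟨fun t => if t ≤ dist x p then α t else β (t - dist x p), ?_, by simp [hxp, hα0],
    by simp [hα1], ?_⟩
  · intro s hs t ht
    dsimp only
    split_ifs with h1 h2 h2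
    · exact hα s ⟨hs.1, h1⟩ t ⟨ht.1, h2⟩
    · rw [key s ⟨hs.1, h1⟩ _ ⟨by linarith, by linarith [ht.2]⟩, abs_sub_comm,
        abs_of_nonneg (by linarith)]; ring
    · rw [dist_comm, key t ⟨ht.1, h2⟩ _ ⟨by linarith, by linarith [hs.2]⟩,
        abs_of_nonneg (by linarith)]; ring
    · rw [hβ _ ⟨by linarith, by linarith [hs.2]⟩ _ ⟨by linarith, by linarith [ht.2]⟩]
      congr 1; ring
  · dsimp only
    split_ifs with h1
    · have h2 : dist p y = 0 := by linarith
      rw [dist_eq_zero] at h2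
      subst h2; exact hα1
    · rw [← h, add_sub_cancel_left, hβ1]

/-! ### Limits of isometries -/

/-- Isometries are equicontinuous, so pointwise convergence is already locally uniform. -/
theorem tendsto_isometryEquiv_iff {ι : Type*} {F : Filter ι} {φ : ι → X ≃ᵢ X} {ψ : X ≃ᵢ X} :
    Filter.Tendsto φ F (𝓝 ψ) ↔ ∀ x, Filter.Tendsto (fun i => φ i x) F (𝓝 (ψ x)) := by
  have hind : IsInducing (fun g : X ≃ᵢ X => (⟨g, g.continuous⟩ : C(X, X))) := ⟨rfl⟩
  rw [hind.tendsto_nhds_iff]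
  refine ⟨fun h x => ((continuous_eval_const (F := C(X, X)) x).tendsto _).comp h, fun h => ?_⟩
  refine ContinuousMap.tendsto_of_tendstoLocallyUniformly ?_
  rw [Metric.tendstoLocallyUniformly_iff]
  intro ε hε x
  refine ⟨ball x (ε / 3), ball_mem_nhds _ (by positivity), ?_⟩
  filter_upwards [Metric.tendsto_nhds.1 (h x) (ε / 3) (by positivity)] with i hi y hy
  have h1 := dist_triangle4 (ψ y) (ψ x) (φ i x) (φ i y)
  rw [ψ.isometry.dist_eq, (φ i).isometry.dist_eq, dist_comm x y, dist_comm (ψ x)] at h1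
  rw [mem_ball] at hy
  change dist (ψ y) (φ i y) < ε
  linarith

/-- A family of points that stays in a ball converges along every ultrafilter. -/
theorem exists_tendsto_ultrafilter [ProperSpace X] {ι : Type*} (F : Ultrafilter ι) {f : ι → X}
    {x : X} {R : ℝ} (h : ∀ᶠ i in (F : Filter ι), dist (f i) x ≤ R) :
    ∃ y, Filter.Tendsto f F (𝓝 y) := by
  obtain ⟨y, -, hy⟩ := (isCompact_closedBall x R).ultrafilter_le_nhds (F.map f)
    (Filter.le_principal_iff.2 h)
  exact ⟨y, hy⟩

/-- A family of isometries that moves a point by a bounded amount converges along every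
ultrafilter. -/
theorem exists_tendsto_isometryEquiv [ProperSpace X] {ι : Type*} (F : Ultrafilter ι)
    {φ : ι → X ≃ᵢ X} {x : X} {R : ℝ} (h : ∀ᶠ i in (F : Filter ι), dist (φ i x) x ≤ R) :
    ∃ ψ : X ≃ᵢ X, Filter.Tendsto φ F (𝓝 ψ) := by
  have h1 : ∀ y, ∃ z, Filter.Tendsto (fun i => φ i y) F (𝓝 z) := fun y =>
    exists_tendsto_ultrafilter F (x := x) (R := dist y x + R) <| h.mono fun i hi => by
      have := dist_triangle (φ i y) (φ i x) x
      rw [(φ i).isometry.dist_eq] at this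
      linarith
  -- The inverses move x equally far, so they converge pointwise too; their limit makes the limit
  -- map surjective.
  have h2 : ∀ y, ∃ z, Filter.Tendsto (fun i => (φ i).symm y) F (𝓝 z) := fun y =>
    exists_tendsto_ultrafilter F (x := x) (R := dist y x + R) <| h.mono fun i hi => by
      rw [← (φ i).isometry.dist_eq, (φ i).apply_symm_apply]
      have := dist_triangle_right y (φ i x) x
      linarith
  choose f hf using h1
  choose f' hf' using h2
  have iso : Isometry f := Isometry.of_dist_eq fun y z =>
    tendsto_nhds_unique ((hf y).dist (hf z)) (by simp [(φ _).isometry.dist_eq])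
  have inv1 : ∀ y, f (f' y) = y := fun y => by
    refine tendsto_nhds_unique (hf (f' y)) ?_
    rw [tendsto_iff_dist_tendsto_zero]
    refine (tendsto_iff_dist_tendsto_zero.1 (hf' y)).congr fun i => ?_
    rw [← (φ i).isometry.dist_eq, (φ i).apply_symm_apply, dist_comm]
  refine ⟨⟨⟨f, f', fun y => iso.injective (inv1 (f y)), inv1⟩, iso⟩, ?_⟩
  exact tendsto_isometryEquiv_iff.2 hf

/-! ### Boundary points of rays parametrised by real numbers -/

/-- The ray given by a map on `ℝ` that is geodesic on `[0, ∞)`. -/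
def rayOf (γ : ℝ → X) (h : IsGeodesicOn γ (Ici 0)) : Ray X :=
  ⟨fun t => γ t, Isometry.of_dist_eq fun s t => by
    rw [h s s.2 t t.2, ← Real.dist_eq]; rfl⟩

/-- The class of rays `ξ` contains the restriction of `γ` to `[0, ∞)`, which is a geodesic ray. -/
def EndsAt (γ : ℝ → X) (ξ : Boundary X) : Prop :=
  ∃ h : IsGeodesicOn γ (Ici 0), (rayOf γ h).endpoint = ξ

theorem exists_endsAt (ξ : Boundary X) : ∃ γ : ℝ → X, EndsAt γ ξ := by
  induction ξ using Quotient.inductionOn with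
  | h c =>
    refine ⟨fun t => c.toFun t.toNNReal, fun s hs t ht => ?_, ?_⟩
    · rw [c.isometry'.dist_eq, NNReal.dist_eq, Real.coe_toNNReal _ hs, Real.coe_toNNReal _ ht]
    · refine Quotient.sound ⟨0, fun t => ?_⟩
      simp [rayOf]

theorem EndsAt.geodesic {γ : ℝ → X} {ξ : Boundary X} (h : EndsAt γ ξ) :
    IsGeodesicOn γ (Ici 0) := h.1

theorem EndsAt.unique {γ : ℝ → X} {ξ ζ : Boundary X} (h : EndsAt γ ξ) (h' : EndsAt γ ζ) :
    ξ = ζ := by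
  obtain ⟨_, rfl⟩ := h
  obtain ⟨_, rfl⟩ := h'
  rfl

theorem EndsAt.exists_dist_le {γ η : ℝ → X} {ξ : Boundary X} (h : EndsAt γ ξ) (h' : EndsAt η ξ) :
    ∃ C, ∀ t, 0 ≤ t → dist (γ t) (η t) ≤ C := by
  obtain ⟨h1, rfl⟩ := h
  obtain ⟨h2, h3⟩ := h'
  obtain ⟨C, hC⟩ := Quotient.exact h3
  exact ⟨C, fun t ht => by rw [dist_comm]; exact hC ⟨t, ht⟩⟩

/-- Only large times matter: before time T' each ray is within T' of its position at T', which costs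
2 * T'. -/
theorem EndsAt.of_dist_le {γ η : ℝ → X} {ξ : Boundary X} {C T : ℝ} (h : EndsAt γ ξ)
    (hη : IsGeodesicOn η (Ici 0)) (hC : ∀ t, 0 ≤ t → T ≤ t → dist (η t) (γ t) ≤ C) :
    EndsAt η ξ := by
  obtain ⟨h1, rfl⟩ := h
  set T' := max T 0
  have hT' : 0 ≤ T' := le_max_right _ _
  refine ⟨hη, Quotient.sound ⟨C + 2 * T', fun ⟨t, ht⟩ => ?_⟩⟩
  change dist (η t) (γ t) ≤ _
  by_cases h2 : T' ≤ t
  · have := hC t ht ((le_max_left _ _).trans h2); linarith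
  · have h3 := hC T' hT' (le_max_left _ _)
    have h4 := dist_triangle4 (η t) (η T') (γ T') (γ t)
    rw [hη t ht T' hT', h1 T' hT' t ht, abs_sub_comm, abs_of_nonneg (by linarith)] at h4
    linarith

theorem EndsAt.smul {γ : ℝ → X} {ξ : Boundary X} (h : EndsAt γ ξ) (g : X ≃ᵢ X) :
    EndsAt (fun t => g (γ t)) (g • ξ) := by
  obtain ⟨h1, rfl⟩ := h
  exact ⟨fun s hs t ht => by rw [g.isometry.dist_eq, h1 s hs t ht], rfl⟩

theorem EndsAt.add {γ : ℝ → X} {ξ : Boundary X} (h : EndsAt γ ξ) (hγ : Isometry γ) (s : ℝ) :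
    EndsAt (fun t => γ (t + s)) ξ := by
  refine h.of_dist_le (C := |s|) (T := 0) (.of_isometry (hγ.comp (isometry_add_right s)) _)
    fun t _ _ => ?_
  rw [hγ.dist_eq, Real.dist_eq]; simp

/-- If isometries `φ i` converge to `ψ`, and they map longer and longer parts of a ray to `ξ` into
a uniform neighbourhood of a ray to `ζ`, then `ψ` maps `ξ` to `ζ`. -/
theorem smul_eq_of_tendsto {ι : Type*} {F : Filter ι} [F.NeBot] {φ : ι → X ≃ᵢ X} {ψ : X ≃ᵢ X}
    (hφ : Filter.Tendsto φ F (𝓝 ψ)) {γ η : ℝ → X} {ξ ζ : Boundary X} (hγ : EndsAt γ ξ)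
    (hη : EndsAt η ζ) {C : ℝ}
    (h : ∀ t, 0 ≤ t → ∀ᶠ i in F, dist (φ i (γ t)) (η t) ≤ C) : ψ • ξ = ζ := by
  refine (hγ.smul ψ).unique (hη.of_dist_le (C := C) (T := 0) (hγ.smul ψ).geodesic
    fun t ht _ => ?_)
  exact le_of_tendsto ((tendsto_isometryEquiv_iff.1 hφ (γ t)).dist tendsto_const_nhds) (h t ht)

/-- The distance between a ray to ξ and its asymptotic image under φ i is largest at time 0, where
convergence bounds it uniformly in i. -/
theorem IsCAT0.smul_eq_of_tendsto_of_fixed (hX : IsCAT0 X) {ι : Type*} {F : Filter ι} [F.NeBot]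
    {φ : ι → X ≃ᵢ X} {ψ : X ≃ᵢ X} (hφ : Filter.Tendsto φ F (𝓝 ψ)) {ξ : Boundary X}
    (h : ∀ᶠ i in F, φ i • ξ = ξ) : ψ • ξ = ξ := by
  obtain ⟨γ, hγ⟩ := exists_endsAt ξ
  refine smul_eq_of_tendsto hφ hγ hγ (C := dist (ψ (γ 0)) (γ 0) + 1) fun t ht => ?_
  have h0 := ((tendsto_isometryEquiv_iff.1 hφ (γ 0)).dist
    (tendsto_const_nhds (x := γ 0))).eventually_le_const (lt_add_one _)
  filter_upwards [h, h0] with i hi hi0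
  have h1 : EndsAt (fun t => φ i (γ t)) ξ := hi ▸ hγ.smul (φ i)
  obtain ⟨C, hC⟩ := h1.exists_dist_le hγ
  exact (hX.dist_le_of_bounded h1.geodesic hγ.geodesic hC ht).trans hi0

/-- A closed group of isometries contains the limits of its elements that move a point by a bounded
amount. -/
theorem exists_tendsto_mem [ProperSpace X] {G : Subgroup (X ≃ᵢ X)}
    (hG : IsClosed (G : Set (X ≃ᵢ X))) {ι : Type*} (F : Ultrafilter ι) {φ : ι → X ≃ᵢ X}
    (hφ : ∀ i, φ i ∈ G) {x : X} {R : ℝ} (h : ∀ᶠ i in (F : Filter ι), dist (φ i x) x ≤ R) :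
    ∃ ψ ∈ G, Filter.Tendsto φ F (𝓝 ψ) := by
  obtain ⟨ψ, hψ⟩ := exists_tendsto_isometryEquiv F h
  exact ⟨ψ, hG.mem_of_tendsto hψ (Filter.Eventually.of_forall hφ), hψ⟩

/-- Arzelà–Ascoli for ultrafilters: bounded displacement of x gives a limit, and fixing ξ and ζ
passes to it. -/
theorem IsCAT0.isCompact_stabilizer [ProperSpace X] (hX : IsCAT0 X) {G : Subgroup (X ≃ᵢ X)}
    (hG : IsClosed (G : Set (X ≃ᵢ X))) {ξ ζ : Boundary X} {x : X} {R : ℝ}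
    (h : ∀ u ∈ G, u • ξ = ξ → u • ζ = ζ → dist (u x) x ≤ R) :
    IsCompact (MulAction.stabilizer G (ξ, ζ) : Set G) := by
  have hmem : ∀ u : G, u ∈ MulAction.stabilizer G (ξ, ζ) ↔
      (u : X ≃ᵢ X) • ξ = ξ ∧ (u : X ≃ᵢ X) • ζ = ζ := fun u => by
    rw [MulAction.mem_stabilizer_iff, Prod.smul_mk, Prod.mk.injEq]; rfl
  rw [isCompact_iff_ultrafilter_le_nhds]
  intro F hF
  have hF' : ∀ᶠ u : G in (F : Filter G), u ∈ MulAction.stabilizer G (ξ, ζ) :=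
    Filter.le_principal_iff.1 hF
  obtain ⟨ψ, hψG, hψ⟩ := exists_tendsto_mem hG F (φ := fun u : G => (u : X ≃ᵢ X))
    (fun u => u.2) (x := x) (R := R)
    (hF'.mono fun u hu => h u u.2 ((hmem u).1 hu).1 ((hmem u).1 hu).2)
  refine ⟨⟨ψ, hψG⟩, (hmem _).2 ⟨?_, ?_⟩, ?_⟩
  · exact hX.smul_eq_of_tendsto_of_fixed hψ (hF'.mono fun u hu => ((hmem u).1 hu).1)
  · exact hX.smul_eq_of_tendsto_of_fixed hψ (hF'.mono fun u hu => ((hmem u).1 hu).2)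
  · rw [nhds_subtype_eq_comap]
    exact Filter.tendsto_iff_comap.1 hψ

/-! ### Contracting sets -/

theorem IsGeodesicOn.dist_of_le {γ : ℝ → X} {J : Set ℝ} (h : IsGeodesicOn γ J) {s t : ℝ}
    (hs : s ∈ J) (ht : t ∈ J) (hst : s ≤ t) : dist (γ s) (γ t) = t - s := by
  rw [h s hs t ht, abs_sub_comm, abs_of_nonneg (sub_nonneg.2 hst)]

theorem IsGeodesicOn.continuousOn {γ : ℝ → X} {J : Set ℝ} (h : IsGeodesicOn γ J) :
    ContinuousOn γ J := by
  have : LipschitzOnWith 1 γ J := LipschitzOnWith.of_dist_le_mul fun s hs t ht => by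
    rw [h s hs t ht, NNReal.coe_one, one_mul, Real.dist_eq]
  exact this.continuousOn

/-- `π` is a shortest distance projection to `A`. -/
def IsProjectionMap (A : Set X) (π : X → X) : Prop := ∀ x, IsProjection A x (π x)

namespace IsProjectionMap

variable {A : Set X} {π : X → X} {B : ℝ}

theorem dist_le (hπ : IsProjectionMap A π) (x : X) {y : X} (hy : y ∈ A) :
    dist x (π x) ≤ dist x y := (hπ x).2 y hy

theorem dist_le_add (hπ : IsProjectionMap A π) (x y : X) :
    dist x (π x) ≤ dist x y + dist y (π y) :=
  (hπ.dist_le x (hπ y).1).trans (dist_triangle _ _ _)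

theorem continuous_dist (hπ : IsProjectionMap A π) : Continuous fun x => dist x (π x) := by
  have : LipschitzWith 1 fun x => dist x (π x) := LipschitzWith.of_le_add fun x y => by
    have := hπ.dist_le_add x y; linarith
  exact this.continuous

theorem disjoint_closedBall (hπ : IsProjectionMap A π) {x : X} {r : ℝ} (hr : r < dist x (π x)) :
    Disjoint (closedBall x r) A := by
  rw [Set.disjoint_left]
  intro y hy hyA
  have := hπ.dist_le x hyA
  rw [mem_closedBall, dist_comm] at hy
  linarith

theorem dist_le_of_contracting (hπ : IsProjectionMap A π) (hA : IsContracting B A) {x y : X}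
    {r : ℝ} (hr : r < dist x (π x)) (hy : dist x y ≤ r) : dist (π x) (π y) ≤ B :=
  hA x r (hπ.disjoint_closedBall hr) x (by simpa using dist_nonneg.trans hy) y
    (by rwa [mem_closedBall, dist_comm]) _ _ (hπ x) (hπ y)

/-- Along a geodesic that stays away from a contracting set the projection moves slowly. -/
theorem dist_le_of_far (hπ : IsProjectionMap A π) (hA : IsContracting B A) (hB : 0 < B)
    {σ : ℝ → X} {s t : ℝ} (hst : s ≤ t) (hσ : IsGeodesicOn σ (Icc s t))
    (h : ∀ u ∈ Ico s t, 4 * B < dist (σ u) (π (σ u))) :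
    dist (π (σ s)) (π (σ t)) ≤ (t - s) / 4 + B := by
  -- Steps of length 4 * B stay in balls disjoint from A, so each moves the projection by at most B.
  have key : ∀ n : ℕ, ∀ v ∈ Icc s t, v - s ≤ (n + 1) * (4 * B) →
      dist (π (σ s)) (π (σ v)) ≤ (n + 1) * B := by
    intro n
    induction n with
    | zero =>
      intro v hv hvs
      rcases hv.1.eq_or_lt with rfl | hsv
      · simp [hB.le]
      · have := hπ.dist_le_of_contracting hA (h s ⟨le_rfl, hsv.trans_le hv.2⟩) (y := σ v)
          (by rw [hσ.dist_of_le ⟨le_rfl, hst⟩ hv hv.1]; simpa using hvs)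
        simpa using this
    | succ n ih =>
      intro v hv hvs
      by_cases h1 : v - s ≤ (n + 1) * (4 * B)
      · have := ih v hv h1
        push_cast
        linarith
      · push_cast at hvs ⊢
        push Not at h1
        have h0 : (0 : ℝ) ≤ n * B := by positivity
        have hw : v - 4 * B ∈ Icc s t := ⟨by linarith, by linarith [hv.2]⟩
        have h2 := ih _ hw (by linarith)
        have h3 := hπ.dist_le_of_contracting hA (h (v - 4 * B) ⟨hw.1, by linarith [hv.2]⟩)
          (y := σ v) (by rw [hσ.dist_of_le hw hv (by linarith)]; linarith)
        have := dist_triangle (π (σ s)) (π (σ (v - 4 * B))) (π (σ v))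
        linarith
  have hd : 0 ≤ (t - s) / (4 * B) := div_nonneg (sub_nonneg.2 hst) (by positivity)
  have h1 := key ⌊(t - s) / (4 * B)⌋₊ t ⟨hst, le_rfl⟩ (by
    rw [← div_le_iff₀ (by positivity)]; exact (Nat.lt_floor_add_one _).le)
  have h2 : (⌊(t - s) / (4 * B)⌋₊ : ℝ) * B ≤ (t - s) / 4 := by
    refine (mul_le_mul_of_nonneg_right (Nat.floor_le hd) hB.le).trans (le_of_eq ?_)
    field_simp
  linarith

/-- The margin B makes the radius strictly smaller than the distance to A; the maximum with 0 covers
points within B of A, for which x = y. -/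
theorem dist_le_of_dist_le_sub (hπ : IsProjectionMap A π) (hA : IsContracting B A) (hB : 0 < B)
    {x y : X} (h : dist x y ≤ max (dist x (π x) - B) 0) : dist (π x) (π y) ≤ B := by
  rcases le_total (dist x (π x) - B) 0 with h1 | h1
  · rw [max_eq_right h1] at h
    have : x = y := dist_le_zero.1 h
    simp [this, hB.le]
  · rw [max_eq_left h1] at h
    exact hπ.dist_le_of_contracting hA (by linarith) h

/-- A geodesic whose endpoints have distant projections to a contracting set passes near these
projections. -/
theorem exists_dist_le (hπ : IsProjectionMap A π) (hA : IsContracting B A) (hB : 0 < B)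
    {σ : ℝ → X} {l : ℝ} (hl : 0 ≤ l) (hσ : IsGeodesicOn σ (Icc 0 l))
    (h : 5 * B < dist (π (σ 0)) (π (σ l))) :
    ∃ s t, 0 ≤ s ∧ s ≤ t ∧ t ≤ l ∧ dist (σ s) (π (σ 0)) ≤ 11 * B ∧
      dist (σ t) (π (σ l)) ≤ 11 * B := by
  set x := σ 0
  set y := σ l
  have h0 : (0 : ℝ) ∈ Icc 0 l := ⟨le_rfl, hl⟩
  have h1 : l ∈ Icc 0 l := ⟨hl, le_rfl⟩
  have hxy : dist x y = l := by rw [hσ.dist_of_le h0 h1 hl, sub_zero]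
  set ux := max (dist x (π x) - B) 0 with hux
  set uy := max (dist y (π y) - B) 0 with huy
  have hux0 : 0 ≤ ux := le_max_right _ _
  have huy0 : 0 ≤ uy := le_max_right _ _
  have hux1 : dist x (π x) - B ≤ ux := le_max_left _ _
  have huy1 : dist y (π y) - B ≤ uy := le_max_left _ _
  -- On the end pieces of lengths ux and uy the projection stays within B of π x and π y. If they
  -- met, π x and π y would be within 2 * B.
  have hlt : ux + uy < l := by
    by_contra! hcon
    have hm : min ux l ∈ Icc 0 l := ⟨le_min hux0 hl, min_le_right _ _⟩
    have h2 : dist (π x) (π (σ (min ux l))) ≤ B := hπ.dist_le_of_dist_le_sub hA hB (by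
      rw [hσ.dist_of_le h0 hm hm.1, sub_zero]; exact min_le_left _ _)
    have h3 : dist (π y) (π (σ (min ux l))) ≤ B := hπ.dist_le_of_dist_le_sub hA hB (by
      rw [dist_comm, hσ.dist_of_le hm h1 hm.2, ← huy]
      rcases min_choice ux l with h | h <;> rw [h] <;> linarith)
    have := dist_triangle_right (π x) (π y) (π (σ (min ux l)))
    linarith
  set L := dist (π x) (π y)
  have hlL : l ≤ dist x (π x) + L + dist y (π y) := by
    rw [← hxy, dist_comm y]; exact dist_triangle4 _ _ _ _
  set s₀ := ux
  set t₀ := l - uy with ht₀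
  have hst₀ : s₀ ≤ t₀ := by linarith
  have hsub : Icc s₀ t₀ ⊆ Icc 0 l := Icc_subset_Icc hux0 (by linarith)
  have hs₀ : dist (π x) (π (σ s₀)) ≤ B := hπ.dist_le_of_dist_le_sub hA hB (by
    rw [hσ.dist_of_le h0 (hsub ⟨le_rfl, hst₀⟩) hux0, sub_zero])
  have ht₀' : dist (π y) (π (σ t₀)) ≤ B := hπ.dist_le_of_dist_le_sub hA hB (by
    rw [dist_comm, hσ.dist_of_le (hsub ⟨hst₀, le_rfl⟩) h1 (by linarith), ← huy]; linarith)
  have hlen : t₀ - s₀ ≤ L + 2 * B := by linarith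
  have hL : L ≤ dist (π (σ s₀)) (π (σ t₀)) + 2 * B := by
    have := dist_triangle4_right (π x) (π y) (π (σ s₀)) (π (σ t₀))
    linarith
  set S : Set ℝ := Icc s₀ t₀ ∩ (fun u => dist (σ u) (π (σ u))) ⁻¹' Iic (4 * B) with hS
  have hScomp : IsCompact S := isCompact_Icc.of_isClosed_subset
    ((hπ.continuous_dist.comp_continuousOn (hσ.mono hsub).continuousOn).preimage_isClosed_of_isClosed
      isClosed_Icc isClosed_Iic) inter_subset_left
  -- Otherwise L - 2 * B ≤ (L + 2 * B) / 4 + B, against 5 * B < L.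
  have hSne : S.Nonempty := by
    by_contra hne
    have := hπ.dist_le_of_far hA hB hst₀ (hσ.mono hsub) fun u hu => by
      by_contra! hcon
      exact hne ⟨u, ⟨hu.1, hu.2.le⟩, hcon⟩
    linarith
  obtain ⟨s₁, ⟨hs₁, hfs₁⟩, hleast⟩ := hScomp.exists_isLeast hSne
  obtain ⟨t₁, ⟨ht₁, hft₁⟩, hgreatest⟩ := hScomp.exists_isGreatest hSne
  have hst₁ : s₁ ≤ t₁ := hleast ⟨ht₁, hft₁⟩
  simp only [mem_preimage, mem_Iic] at hfs₁ hft₁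
  -- Between s₀ and s₁ and between t₁ and t₀ the projection has speed about 1/4. As t₀ - s₀ ≤ L + 2
  -- * B, these two far pieces have total length at most 56/3 * B, which gives 4 * B + (14/3 * B +
  -- B) + B ≤ 11 * B.
  have c1 := hπ.dist_le_of_far hA hB hs₁.1
    (hσ.mono ((Icc_subset_Icc le_rfl hs₁.2).trans hsub)) fun u hu => by
      by_contra! hcon
      have := hleast ⟨⟨hu.1, hu.2.le.trans hs₁.2⟩, hcon⟩
      linarith [hu.2]
  have c2 := hπ.dist_le_of_far hA hB (σ := fun u => σ (0 - u)) (neg_le_neg ht₁.2)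
    (hσ.comp_sub 0 fun u hu => hsub ⟨by linarith [hu.2, ht₁.1], by linarith [hu.1]⟩)
    fun u hu => by
      by_contra! hcon
      have := hgreatest ⟨⟨by linarith [hu.2, ht₁.1], by linarith [hu.1]⟩, hcon⟩
      linarith [hu.2]
  simp only [zero_sub, neg_neg] at c2
  have c3 : dist (σ s₁) (σ t₁) = t₁ - s₁ := hσ.dist_of_le (hsub hs₁) (hsub ht₁) hst₁
  have c4 := dist_triangle4 (π (σ s₁)) (σ s₁) (σ t₁) (π (σ t₁))
  have c5 := dist_triangle4 (π (σ s₀)) (π (σ s₁)) (π (σ t₁)) (π (σ t₀))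
  rw [dist_comm (π (σ s₁)) (σ s₁)] at c4
  rw [dist_comm (π (σ t₀))] at c2
  have d1 := dist_triangle4 (σ s₁) (π (σ s₁)) (π (σ s₀)) (π x)
  have d2 := dist_triangle4 (σ t₁) (π (σ t₁)) (π (σ t₀)) (π y)
  rw [dist_comm (π (σ s₁)) (π (σ s₀)), dist_comm (π (σ s₀)) (π x)] at d1
  rw [dist_comm (π (σ t₀)) (π y)] at d2
  refine ⟨s₁, t₁, (hsub hs₁).1, hst₁, (hsub ht₁).2, ?_, ?_⟩
  · linarith [hs₁.1, ht₁.2]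
  · linarith [hs₁.1, ht₁.2]

end IsProjectionMap

/-! ### Contracting lines -/

/-- `P` assigns to a point the parameter of a projection to the line `η`. -/
def IsProjectionParam (η : ℝ → X) (P : X → ℝ) : Prop :=
  IsProjectionMap (range η) fun x => η (P x)

theorem exists_isProjectionParam [ProperSpace X] {η : ℝ → X} (hη : Isometry η) :
    ∃ P, IsProjectionParam η P := by
  have h : ∀ x, ∃ s, IsProjection (range η) x (η s) := fun x => by
    obtain ⟨y, ⟨s, rfl⟩, hy⟩ := hη.isClosedEmbedding.isClosed_range.exists_infDist_eq_dist
      (range_nonempty η) x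
    exact ⟨s, mem_range_self s, fun q hq => hy ▸ infDist_le_dist_of_mem hq⟩
  choose P hP using h
  exact ⟨P, hP⟩

section Line

variable {η : ℝ → X} {P : X → ℝ} {B : ℝ}

theorem IsProjectionParam.apply_self (hP : IsProjectionParam η P) (hη : Isometry η) (s : ℝ) :
    P (η s) = s := by
  have := hP.dist_le (η s) (mem_range_self s)
  rw [dist_self] at this
  exact (hη.injective (dist_le_zero.1 this)).symm

theorem IsProjectionParam.neg (hP : IsProjectionParam η P) :
    IsProjectionParam (fun t => η (-t)) fun x => -P x := fun x => by
  have h : range (fun t => η (-t)) = range η := (neg_surjective (G := ℝ)).range_comp η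
  simpa [h] using hP x

theorem IsContracting.neg (h : IsContracting B (range η)) :
    IsContracting B (range fun t => η (-t)) := by
  rwa [show range (fun t => η (-t)) = range η from (neg_surjective (G := ℝ)).range_comp η]

theorem IsProjectionParam.map (hP : IsProjectionParam η P) (g : X ≃ᵢ X) :
    IsProjectionParam (fun t => g (η t)) fun x => P (g.symm x) := fun x => by
  refine ⟨mem_range_self _, ?_⟩
  rintro _ ⟨s, rfl⟩
  have := (hP (g.symm x)).2 (η s) (mem_range_self s)
  rwa [← g.isometry.dist_eq, ← g.isometry.dist_eq (g.symm x), g.apply_symm_apply] at this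

theorem IsContracting.map (h : IsContracting B (range η)) (g : X ≃ᵢ X) :
    IsContracting B (range fun t => g (η t)) := by
  have key : ∀ y p, IsProjection (range fun t => g (η t)) y p →
      IsProjection (range η) (g.symm y) (g.symm p) := by
    rintro y p ⟨⟨s, rfl⟩, hp⟩
    refine ⟨⟨s, (g.symm_apply_apply _).symm⟩, ?_⟩
    rintro _ ⟨t, rfl⟩
    have := hp (g (η t)) ⟨t, rfl⟩
    rw [← g.symm.isometry.dist_eq, ← g.symm.isometry.dist_eq y] at this
    simpa using this
  intro x r hd y hy z hz p q hp hq
  rw [← g.symm.isometry.dist_eq]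
  refine h (g.symm x) r ?_ (g.symm y) ?_ (g.symm z) ?_ _ _ (key y p hp) (key z q hq)
  · rw [Set.disjoint_left] at hd ⊢
    rintro _ hw ⟨t, rfl⟩
    refine hd (a := g (η t)) ?_ ⟨t, rfl⟩
    rwa [mem_closedBall, ← g.symm.isometry.dist_eq, g.symm_apply_apply]
  · rwa [mem_closedBall, g.symm.isometry.dist_eq]
  · rwa [mem_closedBall, g.symm.isometry.dist_eq]

/-- A geodesic whose endpoints have distant projections to a contracting line passes near all
points of the line between these projections. -/
theorem IsCAT0.exists_dist_le (hX : IsCAT0 X) (hη : Isometry η) (hP : IsProjectionParam η P)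
    (hA : IsContracting B (range η)) (hB : 0 < B) {σ : ℝ → X} {l q : ℝ} (hl : 0 ≤ l)
    (hσ : IsGeodesicOn σ (Icc 0 l)) (h : 5 * B < P (σ l) - P (σ 0)) (hq : P (σ 0) ≤ q)
    (hq' : q ≤ P (σ l)) : ∃ s ∈ Icc 0 l, dist (σ s) (η q) ≤ 11 * B := by
  have hlt : 0 < P (σ l) - P (σ 0) := by linarith
  obtain ⟨s, t, hs, hst, ht, h1, h2⟩ := IsProjectionMap.exists_dist_le hP hA hB hl hσ (by
    rw [hη.dist_eq, Real.dist_eq, abs_sub_comm]; exact h.trans_le (le_abs_self _))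
  set m := (q - P (σ 0)) / (P (σ l) - P (σ 0)) with hm
  have hm1 : m ∈ Icc (0 : ℝ) 1 :=
    ⟨div_nonneg (by linarith) hlt.le, (div_le_one hlt).2 (by linarith)⟩
  have h3 := hX.dist_convex hst (sub_nonneg.1 hlt.le)
    (hσ.mono (Icc_subset_Icc hs ht)) (.of_isometry hη _) hm1
  have e : P (σ 0) + m * (P (σ l) - P (σ 0)) = q := by rw [hm]; field_simp; ring
  rw [e] at h3
  refine ⟨s + m * (t - s), ⟨?_, ?_⟩, ?_⟩
  · nlinarith [hm1.1]
  · nlinarith [hm1.2]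
  · nlinarith [hm1.1, hm1.2]

/-- A ray asymptotic to a contracting line is finally uniformly close to it. -/
theorem IsCAT0.exists_dist_le_of_asymptotic (hX : IsCAT0 X) (hη : Isometry η)
    (hP : IsProjectionParam η P) (hA : IsContracting B (range η)) (hB : 0 < B) {σ : ℝ → X}
    {C : ℝ} (hσ : IsGeodesicOn σ (Ici 0)) (hC : ∀ t, 0 ≤ t → dist (σ t) (η t) ≤ C) :
    ∃ s T, 0 ≤ T ∧ ∀ t, T ≤ t → dist (σ t) (η (t + s)) ≤ 4 * B := by
  have hC0 : 0 ≤ C := dist_nonneg.trans (hC 0 le_rfl)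
  obtain ⟨t₀, ht₀, h0⟩ : ∃ t, 0 ≤ t ∧ dist (σ t) (η (P (σ t))) ≤ 4 * B := by
    by_contra! hcon
    -- Staying far from η up to time t would force t ≤ 2 * C + t / 4 + B.
    set t := 4 * C + 4 * B
    have ht : 0 ≤ t := by positivity
    have h1 := IsProjectionMap.dist_le_of_far hP hA hB ht (hσ.mono Icc_subset_Ici_self)
      fun u hu => hcon u hu.1
    have h2 := (hP.dist_le (σ 0) (mem_range_self 0)).trans (hC 0 le_rfl)
    have h3 := (hP.dist_le (σ t) (mem_range_self t)).trans (hC t ht)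
    have h4 := dist_triangle4 (σ 0) (η (P (σ 0))) (η (P (σ t))) (σ t)
    rw [hσ.dist_of_le (mem_Ici.2 le_rfl) ht ht, dist_comm _ (σ t)] at h4
    simp only [t] at *
    linarith
  -- This shift aligns η with σ at time t₀; afterwards the distance cannot grow.
  set s := P (σ t₀) - t₀
  refine ⟨s, t₀, ht₀, fun t ht => ?_⟩
  have hs : Isometry fun t => η (t + s) := hη.comp (isometry_add_right s)
  have h1 := hX.dist_le_of_bounded (α := σ) (β := fun t => η (t + s)) (a := t₀) (C := C + |s|)
    (hσ.mono fun u hu => ht₀.trans hu) (.of_isometry hs _) (fun u hu => by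
      have := dist_triangle (σ u) (η u) (η (u + s))
      rw [hη.dist_eq u, Real.dist_eq, sub_add_cancel_left, abs_neg] at this
      have := hC u (ht₀.trans hu)
      linarith) ht
  simp only [s, add_sub_cancel] at h1 h0
  exact h1.trans h0

end Line

/-! ### Lines and boundary points -/

theorem comp_neg_isometry {γ : ℝ → X} (h : Isometry γ) : Isometry fun t => γ (-t) :=
  Isometry.of_dist_eq fun s t => by rw [h.dist_eq, dist_neg_neg]

/-- A ray that is close to points of the positive half of a line at arbitrarily large times is
asymptotic to it. -/
theorem IsCAT0.endsAt_of_frequently (hX : IsCAT0 X) {η c : ℝ → X} (hη : Isometry η)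
    {ξ : Boundary X} (hc : EndsAt c ξ) {C : ℝ}
    (h : ∀ N : ℝ, ∃ t, N ≤ t ∧ ∃ s, 0 ≤ s ∧ dist (c t) (η s) ≤ C) : EndsAt η ξ := by
  refine hc.of_dist_le (C := 2 * (dist (c 0) (η 0) + C)) (T := 0) (.of_isometry hη _)
    fun u hu _ => ?_
  -- So late a time t forces s ≥ u, and fellow travelling applies at time u.
  obtain ⟨t, ht, s, hs, hts⟩ := h (u + dist (c 0) (η 0) + C)
  have hC : 0 ≤ C := dist_nonneg.trans hts
  have hD := dist_nonneg (x := c 0) (y := η 0)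
  have hus : u ≤ s := by
    have h1 := dist_triangle4 (c 0) (η 0) (η s) (c t)
    rw [hc.geodesic.dist_of_le (mem_Ici.2 le_rfl) (mem_Ici.2 (by linarith)) (by linarith),
      hη.dist_eq, Real.dist_eq, zero_sub, abs_neg, abs_of_nonneg hs, dist_comm _ (c t)] at h1
    linarith
  rw [dist_comm]
  exact hX.fellow_travel (hc.geodesic.mono Icc_subset_Ici_self) (.of_isometry hη _) le_rfl hts hu
    (by linarith) hus

theorem zpow_apply_axis {g : X ≃ᵢ X} {γ : ℝ → X} {τ : ℝ} (hg : ∀ t, g (γ t) = γ (t + τ))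
    (k : ℤ) (t : ℝ) : (g ^ k) (γ t) = γ (t + k * τ) := by
  induction k using Int.induction_on generalizing t with
  | zero => simp
  | succ n ih =>
    rw [zpow_add_one, IsometryEquiv.coe_mul, Function.comp_apply, hg, ih]
    congr 1; push_cast; ring
  | pred n ih =>
    have h : g⁻¹ (γ t) = γ (t - τ) := by
      have := hg (t - τ)
      rw [sub_add_cancel] at this
      rw [← this]; exact g.symm_apply_apply _
    rw [zpow_sub_one, IsometryEquiv.coe_mul, Function.comp_apply, h, ih]
    congr 1; push_cast; ring

/-- A rank-one isometry fixes no boundary points besides the endpoints of a contracting axis. -/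
theorem IsCAT0.endsAt_or_of_fixed [ProperSpace X] (hX : IsCAT0 X) {g : X ≃ᵢ X} {γ : ℝ → X}
    {B τ : ℝ} (hγ : Isometry γ) (hA : IsContracting B (range γ)) (hτ : 0 < τ)
    (hg : ∀ t, g (γ t) = γ (t + τ)) {ξ : Boundary X} (hξ : g • ξ = ξ) :
    EndsAt γ ξ ∨ EndsAt (fun t => γ (-t)) ξ := by
  obtain ⟨P, hP⟩ := exists_isProjectionParam hγ
  obtain ⟨n, hn⟩ := exists_nat_gt (B / τ)
  rw [div_lt_iff₀ hτ] at hn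
  set f := g ^ (n : ℤ)
  have hf : ∀ t, f (γ t) = γ (t + n * τ) := fun t => by
    exact (zpow_apply_axis hg n t).trans (by simp)
  have hfξ : f • ξ = ξ := by
    have : g ∈ MulAction.stabilizer (X ≃ᵢ X) ξ := hξ
    exact zpow_mem this n
  obtain ⟨c, hc⟩ := exists_endsAt ξ
  obtain ⟨C, hC⟩ := hc.exists_dist_le (hfξ ▸ hc.smul f)
  have hrange : range (fun t => f (γ t)) = range γ := by
    ext y; constructor
    · rintro ⟨t, rfl⟩; exact ⟨t + n * τ, (hf t).symm⟩
    · rintro ⟨t, rfl⟩; exact ⟨t - n * τ, by simp [hf]⟩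
  -- Otherwise a ball around c t that misses the axis contains f (c t), although the projections of
  -- these points are n * τ > B apart.
  have hclose : ∀ t, 0 ≤ t → dist (c t) (γ (P (c t))) ≤ C := fun t ht => by
    by_contra! hcon
    have h1 := hP.map f (f (c t))
    rw [hrange] at h1
    have h2 := hA (c t) C (IsProjectionMap.disjoint_closedBall hP hcon) (c t)
      (by simpa using dist_nonneg.trans (hC t ht)) (f (c t))
      (by rw [mem_closedBall, dist_comm]; exact hC t ht) _ _ (hP (c t)) h1
    simp only [f.symm_apply_apply, hf, hγ.dist_eq, Real.dist_eq, sub_add_cancel_left, abs_neg]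
      at h2
    linarith [le_abs_self (n * τ)]
  by_cases hfr : ∀ N : ℝ, ∃ t, N ≤ t ∧ 0 ≤ P (c t)
  · left
    refine hX.endsAt_of_frequently hγ hc (C := C) fun N => ?_
    obtain ⟨t, ht, h0⟩ := hfr (max N 0)
    exact ⟨t, (le_max_left _ _).trans ht, _, h0, hclose t ((le_max_right _ _).trans ht)⟩
  · right
    push Not at hfr
    obtain ⟨N₀, hN₀⟩ := hfr
    refine hX.endsAt_of_frequently (comp_neg_isometry hγ) hc (C := C) fun N => ?_
    refine ⟨max N (max N₀ 0), le_max_left _ _, -P (c (max N (max N₀ 0))), ?_, ?_⟩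
    rotate_left
    · simp only [neg_neg]
      exact hclose _ ((le_max_right _ _).trans (le_max_right _ _))
    · have := hN₀ _ ((le_max_left N₀ 0).trans (le_max_right N _))
      linarith

/-- A boundary point different from the endpoint of a contracting line can be joined to it by a
line. -/
theorem IsCAT0.exists_line [ProperSpace X] (hX : IsCAT0 X) {η : ℝ → X} {B : ℝ} (hη : Isometry η)
    (hA : IsContracting B (range η)) (hB : 0 < B) {ξ ζ : Boundary X} (hζ : EndsAt η ζ)
    (hne : ξ ≠ ζ) : ∃ ρ : ℝ → X, Isometry ρ ∧ EndsAt ρ ζ ∧ EndsAt (fun t => ρ (-t)) ξ := by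
  obtain ⟨P, hP⟩ := exists_isProjectionParam hη
  obtain ⟨c, hc⟩ := exists_endsAt ξ
  -- If the projections of c were unbounded in the direction of ζ, then c would pass near η
  -- arbitrarily far out and end at ζ.
  obtain ⟨T, hT⟩ : ∃ T, ∀ t, 0 ≤ t → P (c t) ≤ T := by
    by_contra! hcon
    refine hne ((hX.endsAt_of_frequently hη hc (C := 11 * B) fun N => ?_).unique hζ)
    set D := dist (c 0) (η 0)
    have hD : 0 ≤ D := dist_nonneg
    obtain ⟨t, ht, htP⟩ := hcon (max (P (c 0) + 5 * B) (max (N + D + 11 * B) 0))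
    rw [max_lt_iff, max_lt_iff] at htP
    obtain ⟨s, hs, hd⟩ := hX.exists_dist_le hη hP hA hB ht
      (hc.geodesic.mono Icc_subset_Ici_self) (q := P (c t)) (by linarith) (by linarith) le_rfl
    refine ⟨s, ?_, P (c t), htP.2.2.le, hd⟩
    have h1 := dist_triangle4 (η 0) (c 0) (c s) (η (P (c t)))
    rw [hc.geodesic.dist_of_le (mem_Ici.2 le_rfl) hs.1 hs.1, dist_comm _ (c 0), hη.dist_eq,
      Real.dist_eq, zero_sub, abs_neg, abs_of_pos htP.2.2] at h1
    linarith
  set K := dist (c 0) (η T)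
  have hK : 0 ≤ K := dist_nonneg
  -- The projections of the endpoints differ by more than 5 * B, so the segment passes near η T. The
  -- line ρ is the limit of these segments recentred at the passage times u n.
  have hseg : ∀ n : ℕ, ∃ (σ : ℝ → X) (l u : ℝ), IsGeodesicOn σ (Icc 0 l) ∧ σ 0 = c n ∧
      σ l = η (T + (5 * B + 1 + n)) ∧ 0 ≤ u ∧ u ≤ l ∧ dist (σ u) (η T) ≤ 11 * B := fun n => by
    obtain ⟨σ, hσ, h0, h1⟩ := hX.exists_geodesic (c n) (η (T + (5 * B + 1 + n)))
    have hPl := hP.apply_self hη (T + (5 * B + 1 + n))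
    have hn : (0 : ℝ) ≤ n := n.cast_nonneg
    have hPc := hT n hn
    obtain ⟨u, hu, hd⟩ := hX.exists_dist_le hη hP hA hB dist_nonneg hσ (q := T)
      (by rw [h0, h1, hPl]; linarith) (by rwa [h0]) (by rw [h1, hPl]; linarith)
    exact ⟨σ, _, u, hσ, h0, h1, hu.1, hu.2, hd⟩
  choose σ l u hσ hσ0 hσl hu0 hul hdu using hseg
  have hu : ∀ n : ℕ, n - K - 11 * B ≤ u n := fun n => by
    have hn : (0 : ℝ) ≤ n := n.cast_nonneg
    have h1 := dist_triangle4 (c 0) (η T) (σ n (u n)) (σ n 0)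
    rw [dist_comm (η T), dist_comm _ (σ n 0), dist_comm (σ n (u n)) (σ n 0), (hσ n).dist_of_le ⟨le_rfl, (hu0 n).trans (hul n)⟩
      ⟨hu0 n, hul n⟩ (hu0 n), hσ0, dist_comm (c n), hc.geodesic.dist_of_le (mem_Ici.2 le_rfl) hn hn] at h1
    linarith [hdu n]
  have hl : ∀ n : ℕ, n - K - 11 * B ≤ l n - u n := fun n => by
    have hn : (0 : ℝ) ≤ n := n.cast_nonneg
    have h1 := dist_triangle (η T) (σ n (u n)) (σ n (l n))
    rw [dist_comm (η T) (σ n (u n)), (hσ n).dist_of_le ⟨hu0 n, hul n⟩ ⟨(hu0 n).trans (hul n), le_rfl⟩ (hul n),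
      hσl, hη.dist_eq, dist_self_add_right, Real.norm_of_nonneg (by positivity)] at h1
    linarith [hdu n]
  set F : Ultrafilter ℕ := Filter.hyperfilter ℕ
  have hev : ∀ R : ℝ, ∀ᶠ n : ℕ in (F : Filter ℕ), R ≤ n - K - 11 * B := fun R => by
    refine Filter.Eventually.filter_mono Nat.hyperfilter_le_atTop ?_
    filter_upwards [Filter.eventually_ge_atTop ⌈R + K + 11 * B⌉₊] with n hn
    have := Nat.ceil_le.1 hn
    linarith
  have hmem : ∀ t : ℝ, ∀ᶠ n : ℕ in (F : Filter ℕ), u n + t ∈ Icc 0 (l n) := fun t => by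
    filter_upwards [hev |t|] with n hn
    exact ⟨by linarith [hu n, neg_abs_le t], by linarith [hl n, le_abs_self t]⟩
  have hlim : ∀ t, ∃ y, Filter.Tendsto (fun n => σ n (u n + t)) F (𝓝 y) := fun t => by
    refine exists_tendsto_ultrafilter F (x := η T) (R := |t| + 11 * B) ?_
    filter_upwards [hmem t] with n hn
    have h1 := dist_triangle (σ n (u n + t)) (σ n (u n)) (η T)
    rw [hσ n _ hn _ ⟨hu0 n, hul n⟩, add_sub_cancel_left] at h1
    linarith [hdu n]
  choose ρ hρ using hlim
  have iso : Isometry ρ := Isometry.of_dist_eq fun s t => by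
    refine tendsto_nhds_unique ((hρ s).dist (hρ t)) (tendsto_const_nhds.congr' ?_)
    filter_upwards [hmem s, hmem t] with n hs ht
    rw [hσ n _ hs _ ht, Real.dist_eq, add_sub_add_left_eq_sub]
  refine ⟨ρ, iso, ?_, ?_⟩
  · refine (hζ.add hη T).of_dist_le (C := 2 * (11 * B + 0)) (T := 0) (.of_isometry iso _)
      fun t ht _ => ?_
    refine le_of_tendsto ((hρ t).dist tendsto_const_nhds) ?_
    filter_upwards [hev t] with n hn
    have h1 := hX.fellow_travel (α := fun t => σ n (u n + t)) (β := fun t => η (T + t))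
      (a := l n - u n) (b := 5 * B + 1 + n) (C := 11 * B) (D := 0) (t := t)
      ((hσ n).comp_add _ fun s hs => ⟨by linarith [hs.1, hu0 n], by linarith [hs.2]⟩)
      (.of_isometry (hη.comp (isometry_add_left T)) _) (by simpa using hdu n)
      (by simp [hσl]) ht (by linarith [hl n]) (by linarith)
    rwa [add_comm T t] at h1
  · refine hc.of_dist_le (C := 2 * (11 * B + K + 0)) (T := 0)
      (.of_isometry (comp_neg_isometry iso) _) fun t ht _ => ?_
    refine le_of_tendsto ((hρ (-t)).dist tendsto_const_nhds) ?_
    filter_upwards [hev t] with n hn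
    exact hX.fellow_travel (α := fun t => σ n (u n - t)) (β := c)
      (a := u n) (b := n) (C := 11 * B + K) (D := 0) (t := t)
      ((hσ n).comp_sub _ fun s hs => ⟨by linarith [hs.2], by linarith [hs.1, hul n]⟩)
      (hc.geodesic.mono Icc_subset_Ici_self)
      (by
        have := dist_triangle_right (σ n (u n)) (c 0) (η T)
        rw [sub_zero]; linarith [hdu n])
      (by simp [hσ0]) ht (by linarith [hu n]) (by linarith)

/-- An isometry that fixes the endpoints of a line, one of which is the endpoint of a contracting
line, translates this line up to a uniform error. -/
theorem IsCAT0.exists_translation [ProperSpace X] (hX : IsCAT0 X) {η ρ : ℝ → X} {B : ℝ}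
    (hη : Isometry η) (hA : IsContracting B (range η)) (hB : 0 < B) {ξ ζ : Boundary X}
    (hζ : EndsAt η ζ) (hρ : Isometry ρ) (hρζ : EndsAt ρ ζ) (hρξ : EndsAt (fun t => ρ (-t)) ξ)
    {u : X ≃ᵢ X} (huζ : u • ζ = ζ) (huξ : u • ξ = ξ) :
    ∃ r, ∀ t, dist (u (ρ t)) (ρ (t + r)) ≤ 8 * B := by
  obtain ⟨P, hP⟩ := exists_isProjectionParam hη
  have hu : Isometry fun t => u (ρ t) := u.isometry.comp hρ
  have huρζ : EndsAt (fun t => u (ρ t)) ζ := huζ ▸ hρζ.smul u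
  have huρξ : EndsAt (fun t => u (ρ (-t))) ξ := huξ ▸ hρξ.smul u
  obtain ⟨C₁, hC₁⟩ := hρζ.exists_dist_le hζ
  obtain ⟨C₂, hC₂⟩ := huρζ.exists_dist_le hζ
  obtain ⟨C₃, hC₃⟩ := huρζ.exists_dist_le hρζ
  obtain ⟨C₄, hC₄⟩ := huρξ.exists_dist_le hρξ
  obtain ⟨s₁, T₁, -, h₁⟩ := hX.exists_dist_le_of_asymptotic hη hP hA hB (.of_isometry hρ _) hC₁
  obtain ⟨s₂, T₂, -, h₂⟩ := hX.exists_dist_le_of_asymptotic hη hP hA hB (.of_isometry hu _) hC₂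
  refine ⟨s₂ - s₁, fun t => ?_⟩
  -- With this r, u (ρ T) and ρ (T + r) are both within 4 * B of η (T + s₂) for large T; convexity
  -- in reversed time carries the bound back to t.
  set r := s₂ - s₁ with hr
  set T := max t (max T₂ (T₁ - r))
  have hT₂ : T₂ ≤ T := (le_max_left _ _).trans (le_max_right _ _)
  have hT₁ : T₁ ≤ T + r := by
    have : T₁ - r ≤ T := (le_max_right _ _).trans (le_max_right _ _)
    linarith
  have hend : dist (u (ρ T)) (ρ (T + r)) ≤ 8 * B := by
    have h3 := h₂ T hT₂
    have h4 := h₁ (T + r) hT₁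
    rw [show T + r + s₁ = T + s₂ by rw [hr]; ring] at h4
    have := dist_triangle_right (u (ρ T)) (ρ (T + r)) (η (T + s₂))
    linarith
  have hb : ∀ v : ℝ, dist (u (ρ (-v))) (ρ (-v + r)) ≤ max C₃ C₄ + |r| := fun v => by
    have h3 := dist_triangle (u (ρ (-v))) (ρ (-v)) (ρ (-v + r))
    rw [hρ.dist_eq, Real.dist_eq, sub_add_cancel_left, abs_neg] at h3
    have h4 : dist (u (ρ (-v))) (ρ (-v)) ≤ max C₃ C₄ := by
      rcases le_total 0 v with hv | hv
      · exact (hC₄ v hv).trans (le_max_right _ _)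
      · exact (hC₃ (-v) (by linarith)).trans (le_max_left _ _)
    linarith
  have hrev : Isometry fun v : ℝ => ρ (-v + r) :=
    comp_neg_isometry (hρ.comp (isometry_add_right r))
  have := hX.dist_le_of_bounded (α := fun v => u (ρ (-v))) (β := fun v => ρ (-v + r)) (a := -T)
    (t := -t) (.of_isometry (comp_neg_isometry hu) _) (.of_isometry hrev _)
    (fun v _ => hb v) (neg_le_neg (le_max_left _ _))
  simp only [neg_neg] at this
  exact this.trans hend

/-! ### Limits of rank-one axes -/

/-- The isometry `g` translates the contracting line `γ` from `a` to `b` by `τ > 0`. -/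
structure IsTranslation (g : X ≃ᵢ X) (γ : ℝ → X) (B τ : ℝ) (a b : Boundary X) : Prop where
  isometry : Isometry γ
  contracting : IsContracting B (range γ)
  pos_B : 0 < B
  pos : 0 < τ
  map : ∀ t, g (γ t) = γ (t + τ)
  left : EndsAt (fun t => γ (-t)) a
  right : EndsAt γ b

/-- Any shift along the axis is a power of g up to an error of one period. -/
theorem exists_zpow_dist_le {g : X ≃ᵢ X} {γ : ℝ → X} {B τ : ℝ} {a b : Boundary X}
    (h : IsTranslation g γ B τ a b) (s : ℝ) :
    ∃ k : ℤ, k * τ ≤ s ∧ s ≤ k * τ + τ ∧ ∀ t, dist ((g ^ k) (γ t)) (γ (t + s)) ≤ τ := by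
  have h1 := Int.floor_le (s / τ)
  have h2 := (Int.lt_floor_add_one (s / τ)).le
  rw [le_div_iff₀ h.pos] at h1
  rw [div_le_iff₀ h.pos, add_mul, one_mul] at h2
  refine ⟨⌊s / τ⌋, h1, h2, fun t => ?_⟩
  rw [zpow_apply_axis h.map, h.isometry.dist_eq, dist_add_left, Real.dist_eq, abs_le]
  constructor <;> linarith

/-- If the stabilizer of `(b, e)` is not compact then an element of `G` maps `(b, a)` to
`(b, e)`. -/
theorem IsCAT0.exists_smul_eq_of_not_isCompact [ProperSpace X] (hX : IsCAT0 X)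
    {G : Subgroup (X ≃ᵢ X)} (hG : IsClosed (G : Set (X ≃ᵢ X))) {g : X ≃ᵢ X} (hgG : g ∈ G)
    {γ : ℝ → X} {B τ : ℝ} {a b e : Boundary X} (h : IsTranslation g γ B τ a b) (he : e ≠ b)
    (hnc : ¬ IsCompact (MulAction.stabilizer G (b, e) : Set G)) :
    ∃ φ ∈ G, φ • b = b ∧ φ • a = e := by
  have hB := h.pos_B
  obtain ⟨P, hP⟩ := exists_isProjectionParam h.isometry
  obtain ⟨ρ, hρ, hρb, hρe⟩ := hX.exists_line h.isometry h.contracting hB h.right he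
  obtain ⟨C, hC⟩ := hρb.exists_dist_le h.right
  obtain ⟨s, T, -, hs⟩ := hX.exists_dist_le_of_asymptotic h.isometry hP h.contracting hB
    (.of_isometry hρ _) hC
  -- Otherwise all translation amounts lie in [-n, n], inverses taking care of the sign, and the
  -- stabilizer is compact.
  have hu : ∀ n : ℕ, ∃ u ∈ G, u • b = b ∧ ∃ r : ℝ, n ≤ r ∧
      ∀ t, dist (u (ρ t)) (ρ (t + r)) ≤ 8 * B := fun n => by
    by_contra! hcon
    refine hnc (hX.isCompact_stabilizer hG (x := ρ 0) (R := n + 8 * B) fun u huG hub hue => ?_)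
    obtain ⟨r, hr⟩ := hX.exists_translation h.isometry h.contracting hB h.right hρ hρb hρe hub hue
    have h1 : r ≤ n := by
      by_contra! hr1
      obtain ⟨t, ht⟩ := hcon u huG hub r hr1.le
      linarith [hr t]
    have h2 : -n ≤ r := by
      by_contra! hr1
      obtain ⟨t, ht⟩ := hcon u⁻¹ (inv_mem huG) (by rw [inv_smul_eq_iff, hub]) (-r) (by linarith)
      have h3 := hr (t + -r)
      rw [neg_add_cancel_right] at h3
      have h4 : dist (u⁻¹ (ρ t)) (ρ (t + -r)) = dist (u (ρ (t + -r))) (ρ t) := by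
        rw [← u.isometry.dist_eq, dist_comm]
        congr 1
        exact u.apply_symm_apply _
      linarith
    have h3 := hr 0
    rw [zero_add] at h3
    have h4 := dist_triangle (u (ρ 0)) (ρ r) (ρ 0)
    rw [hρ.dist_eq, Real.dist_eq, sub_zero] at h4
    have : |r| ≤ n := abs_le.2 ⟨h2, h1⟩
    linarith
  choose u huG hub r hnr hur using hu
  choose k _ _ hk using fun n => exists_zpow_dist_le h (r n + s)
  -- Near b the lines γ and ρ are 4 * B-close with shift s. The errors are τ for the power of g, 4 *
  -- B for this closeness and 8 * B for u n.
  have hφ : ∀ (n : ℕ) (v : ℝ), T - v ≤ n →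
      dist (((u n)⁻¹ * g ^ k n) (γ v)) (ρ v) ≤ τ + 12 * B := fun n v hn => by
    have h1 : dist (((u n)⁻¹ * g ^ k n) (γ v)) (ρ v) =
        dist ((g ^ k n) (γ v)) (u n (ρ v)) := by
      rw [← (u n).isometry.dist_eq]
      congr 1
      exact (u n).apply_symm_apply _
    have h2 := hs (v + r n) (by linarith [hnr n])
    rw [dist_comm, add_assoc] at h2
    have h3 := hur n v
    rw [dist_comm] at h3
    have h4 := dist_triangle4 ((g ^ k n) (γ v)) (γ (v + (r n + s))) (ρ (v + r n)) (u n (ρ v))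
    linarith [hk n v]
  have hev : ∀ v : ℝ, ∀ᶠ n : ℕ in (Filter.hyperfilter ℕ : Filter ℕ),
      dist (((u n)⁻¹ * g ^ k n) (γ v)) (ρ v) ≤ τ + 12 * B := fun v => by
    refine Filter.Eventually.filter_mono Nat.hyperfilter_le_atTop ?_
    filter_upwards [Filter.eventually_ge_atTop ⌈T - v⌉₊] with n hn
    exact hφ n v (Nat.ceil_le.1 hn)
  obtain ⟨φ, hφG, hφlim⟩ := exists_tendsto_mem hG (Filter.hyperfilter ℕ)
    (φ := fun n => (u n)⁻¹ * g ^ k n)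
    (fun n => mul_mem (inv_mem (huG n)) (zpow_mem hgG _)) (x := γ 0)
    (R := τ + 12 * B + dist (ρ 0) (γ 0)) ((hev 0).mono fun n hn =>
      (dist_triangle _ (ρ 0) _).trans (add_le_add hn le_rfl))
  exact ⟨φ, hφG, smul_eq_of_tendsto hφlim h.right hρb fun t _ => hev t,
    smul_eq_of_tendsto hφlim h.left hρe fun t _ => hev (-t)⟩

/-! ### Axes passing through two prescribed places -/

section TwoLines

variable {η₁ η₂ : ℝ → X} {P₁ P₂ : X → ℝ} {B : ℝ}

/-- If the projections of two contracting lines to each other lie on the appropriate sides of the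
base points, then a geodesic from the beginning of the first line to the end of the second passes
first near the base point of the first line and then near the base point of the second. -/
theorem IsCAT0.exists_dist_le_of_two_lines (hX : IsCAT0 X) (h₁ : Isometry η₁) (h₂ : Isometry η₂)
    (hP₁ : IsProjectionParam η₁ P₁) (hP₂ : IsProjectionParam η₂ P₂)
    (hA₁ : IsContracting B (range η₁)) (hA₂ : IsContracting B (range η₂)) (hB : 0 < B)
    (h0 : 0 ≤ P₁ (η₂ 0)) {t : ℝ} (ht : 5 * B < t) (htP : P₂ (η₁ (-t)) ≤ 0) :
    ∃ (σ : ℝ → X) (l u v : ℝ), IsGeodesicOn σ (Icc 0 l) ∧ σ 0 = η₁ (-t) ∧ σ l = η₂ t ∧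
      0 ≤ u ∧ u ≤ v ∧ v ≤ l ∧ dist (σ u) (η₁ 0) ≤ 22 * B ∧ dist (σ v) (η₂ 0) ≤ 11 * B := by
  obtain ⟨σ, hσ, hσ0, hσl⟩ := hX.exists_geodesic (η₁ (-t)) (η₂ t)
  obtain ⟨δ, hδ, hδ0, hδl⟩ := hX.exists_geodesic (η₁ (-t)) (η₂ 0)
  set l := dist (η₁ (-t)) (η₂ t)
  set m := dist (η₁ (-t)) (η₂ 0) with hm
  have ht0 : 0 < t := by linarith
  have hm0 : 0 < m := by
    rw [hm, dist_pos]
    intro heq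
    rw [← heq, hP₁.apply_self h₁] at h0
    linarith
  obtain ⟨w, hw, hdw⟩ := hX.exists_dist_le h₁ hP₁ hA₁ hB hm0.le hδ (q := 0)
    (by rw [hδ0, hδl, hP₁.apply_self h₁]; linarith)
    (by rw [hδ0, hP₁.apply_self h₁]; linarith) (by rwa [hδl])
  obtain ⟨v, hv, hdv⟩ := hX.exists_dist_le h₂ hP₂ hA₂ hB dist_nonneg hσ (q := 0)
    (by rw [hσ0, hσl, hP₂.apply_self h₂]; linarith) (by rwa [hσ0])
    (by rw [hσl, hP₂.apply_self h₂]; exact ht0.le)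
  have hl : w / m ∈ Icc (0 : ℝ) 1 := ⟨div_nonneg hw.1 hm0.le, (div_le_one hm0).2 hw.2⟩
  -- σ up to time v and δ start together and end 11 * B-close, and δ w is 11 * B-close to η₁ 0;
  -- hence 22 * B.
  have h3 := hX.dist_convex hv.1 hm0.le (hσ.mono (Icc_subset_Icc le_rfl hv.2)) hδ hl
  rw [hσ0, hδ0, dist_self, hδl, sub_zero, sub_zero, zero_add, zero_add,
    div_mul_cancel₀ _ hm0.ne'] at h3
  refine ⟨σ, l, w / m * v, v, hσ, hσ0, hσl, mul_nonneg hl.1 hv.1, by nlinarith [hl.2, hv.1],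
    hv.2, ?_, hdv⟩
  have h4 := dist_triangle (σ (w / m * v)) (δ w) (η₁ 0)
  have h5 : w / m * dist (σ v) (η₂ 0) ≤ 11 * B := by
    nlinarith [hl.1, hl.2, dist_nonneg (x := σ v) (y := η₂ 0)]
  linarith

/-- The pieces of σ before u and after v have lengths at least t - 22 * B and t - 11 * B. The growth
in t shows that the two lines have different outer ends. -/
theorem IsCAT0.le_dist_of_two_lines (hX : IsCAT0 X) (h₁ : Isometry η₁) (h₂ : Isometry η₂)
    (hP₁ : IsProjectionParam η₁ P₁) (hP₂ : IsProjectionParam η₂ P₂)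
    (hA₁ : IsContracting B (range η₁)) (hA₂ : IsContracting B (range η₂)) (hB : 0 < B)
    (h0 : 0 ≤ P₁ (η₂ 0)) {t : ℝ} (ht : 5 * B < t) (htP : P₂ (η₁ (-t)) ≤ 0) :
    2 * t - 33 * B ≤ dist (η₁ (-t)) (η₂ t) := by
  obtain ⟨σ, l, u, v, hσ, hσ0, hσl, hu, huv, hv, hdu, hdv⟩ :=
    hX.exists_dist_le_of_two_lines h₁ h₂ hP₁ hP₂ hA₁ hA₂ hB h0 ht htP
  have ht0 : 0 < t := by linarith
  have hl : 0 ≤ l := hu.trans (huv.trans hv)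
  have e1 := hσ.dist_of_le ⟨le_rfl, hl⟩ ⟨hu, huv.trans hv⟩ hu
  have e2 := hσ.dist_of_le ⟨hu.trans huv, hv⟩ ⟨hl, le_rfl⟩ hv
  have e3 := hσ.dist_of_le ⟨le_rfl, hl⟩ ⟨hl, le_rfl⟩ hl
  rw [hσ0] at e1
  rw [hσl] at e2
  rw [hσ0, hσl] at e3
  have f1 := dist_triangle (η₁ (-t)) (σ u) (η₁ 0)
  have f2 := dist_triangle_left (η₂ 0) (η₂ t) (σ v)
  rw [h₁.dist_eq, Real.dist_eq, sub_zero, abs_neg, abs_of_pos ht0] at f1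
  rw [h₂.dist_eq, Real.dist_eq, zero_sub, abs_neg, abs_of_pos ht0] at f2
  linarith

/-- In the situation of two lines as above, a contracting line from the beginning of the first line
to the end of the second passes first near the base point of the first line and then near the base
point of the second. -/
theorem IsCAT0.exists_dist_le_of_joining [ProperSpace X] (hX : IsCAT0 X) (h₁ : Isometry η₁)
    (h₂ : Isometry η₂) (hP₁ : IsProjectionParam η₁ P₁) (hP₂ : IsProjectionParam η₂ P₂)
    (hA₁ : IsContracting B (range η₁)) (hA₂ : IsContracting B (range η₂)) (hB : 0 < B)
    (h0 : 0 ≤ P₁ (η₂ 0)) (hP : ∀ N : ℝ, ∃ t, N ≤ t ∧ P₂ (η₁ (-t)) ≤ 0) {ζ : ℝ → X}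
    (hζ : Isometry ζ) (hA : IsContracting B (range ζ)) {x y : Boundary X}
    (hx : EndsAt (fun t => η₁ (-t)) x) (hy : EndsAt η₂ y) (hζx : EndsAt (fun t => ζ (-t)) x)
    (hζy : EndsAt ζ y) :
    ∃ s₁ s₂, s₁ ≤ s₂ ∧ dist (ζ s₁) (η₁ 0) ≤ 26 * B ∧ dist (ζ s₂) (η₂ 0) ≤ 15 * B := by
  obtain ⟨Q, hQ⟩ := exists_isProjectionParam hζ
  obtain ⟨C₁, hC₁⟩ := hx.exists_dist_le hζx
  obtain ⟨C₂, hC₂⟩ := hy.exists_dist_le hζy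
  obtain ⟨r₁, T₁, -, hr₁⟩ := hX.exists_dist_le_of_asymptotic (comp_neg_isometry hζ) hQ.neg hA.neg
    hB hx.geodesic hC₁
  obtain ⟨r₂, T₂, -, hr₂⟩ := hX.exists_dist_le_of_asymptotic hζ hQ hA hB hy.geodesic hC₂
  -- |r₁| + |r₂| puts the two times on ζ in the right order, and 17 * B makes the length of σ, at
  -- least 2 * t - 33 * B, positive.
  obtain ⟨t, ht, htP⟩ := hP (max (max T₁ T₂) (max (|r₁| + |r₂|) (17 * B)))
  simp only [max_le_iff] at ht
  obtain ⟨⟨ht1, ht2⟩, ht3, ht4⟩ := ht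
  have hlt := hX.le_dist_of_two_lines h₁ h₂ hP₁ hP₂ hA₁ hA₂ hB h0 (by linarith) htP
  obtain ⟨σ, l, u, v, hσ, hσ0, hσl, hu, huv, hv, hdu, hdv⟩ :=
    hX.exists_dist_le_of_two_lines h₁ h₂ hP₁ hP₂ hA₁ hA₂ hB h0 (by linarith) htP
  have hl0 : 0 ≤ l := hu.trans (huv.trans hv)
  have hl : 0 < l := by
    have := hσ.dist_of_le ⟨le_rfl, hl0⟩ ⟨hl0, le_rfl⟩ hl0
    rw [hσ0, hσl] at this
    linarith
  have hle : -(t + r₁) ≤ t + r₂ := by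
    linarith [neg_abs_le r₁, neg_abs_le r₂, abs_nonneg r₁, abs_nonneg r₂]
  have hclose : ∀ w ∈ Icc 0 l,
      dist (σ w) (ζ (-(t + r₁) + w / l * (t + r₂ - -(t + r₁)))) ≤ 4 * B := fun w hw => by
    have hw1 : w / l ∈ Icc (0 : ℝ) 1 := ⟨div_nonneg hw.1 hl0, (div_le_one hl).2 hw.2⟩
    have := hX.dist_convex hl0 hle hσ (.of_isometry hζ _) hw1
    rw [sub_zero, zero_add, div_mul_cancel₀ _ hl.ne', hσ0, hσl] at this
    nlinarith [hr₁ t ht1, hr₂ t ht2, hw1.1, hw1.2]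
  refine ⟨_, _, ?_, (dist_triangle_left _ _ (σ u)).trans
    (le_of_le_of_eq (add_le_add (hclose u ⟨hu, huv.trans hv⟩) hdu) (by ring)),
    (dist_triangle_left _ _ (σ v)).trans
    (le_of_le_of_eq (add_le_add (hclose v ⟨hu.trans huv, hv⟩) hdv) (by ring))⟩
  have : u / l ≤ v / l := div_le_div_of_nonneg_right huv hl0
  nlinarith

/-- If a group acts transitively on pairs, translates of the axis `γ` pass through the base points
of two lines. -/
theorem IsCAT0.exists_translate_of_two_lines [ProperSpace X] (hX : IsCAT0 X)
    {G : Subgroup (X ≃ᵢ X)} {g : X ≃ᵢ X} (hgG : g ∈ G)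
    {γ : ℝ → X} {τ : ℝ} {a b : Boundary X} (h : IsTranslation g γ B τ a b)
    {x y : Boundary X} (hxy : x ≠ y → ∃ ψ ∈ G, ψ • a = x ∧ ψ • b = y)
    (h₁ : Isometry η₁) (h₂ : Isometry η₂) (hP₁ : IsProjectionParam η₁ P₁)
    (hP₂ : IsProjectionParam η₂ P₂) (hA₁ : IsContracting B (range η₁))
    (hA₂ : IsContracting B (range η₂)) (h0 : 0 ≤ P₁ (η₂ 0))
    (hP : ∀ N : ℝ, ∃ t, N ≤ t ∧ P₂ (η₁ (-t)) ≤ 0) (hx : EndsAt (fun t => η₁ (-t)) x)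
    (hy : EndsAt η₂ y) :
    ∃ ψ ∈ G, ∃ s, 0 ≤ s ∧ dist (ψ (γ 0)) (η₁ 0) ≤ 26 * B + τ ∧
      dist (ψ (γ s)) (η₂ 0) ≤ 15 * B := by
  have hne : x ≠ y := by
    rintro rfl
    obtain ⟨C, hC⟩ := hx.exists_dist_le hy
    obtain ⟨t, ht, htP⟩ := hP (max (6 * B) (C + 33 * B))
    rw [max_le_iff] at ht
    have hB := h.pos_B
    have h3 := hX.le_dist_of_two_lines h₁ h₂ hP₁ hP₂ hA₁ hA₂ hB h0 (by linarith) htP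
    have h4 := hC t (by linarith)
    linarith
  obtain ⟨ψ, hψG, hψa, hψb⟩ := hxy hne
  obtain ⟨s₁, s₂, hs, hd₁, hd₂⟩ := hX.exists_dist_le_of_joining h₁ h₂ hP₁ hP₂ hA₁ hA₂ h.pos_B h0 hP
    (ψ.isometry.comp h.isometry) (h.contracting.map ψ) hx hy (hψa ▸ h.left.smul ψ)
    (hψb ▸ h.right.smul ψ)
  -- Sliding by g ^ k brings the base point within τ of γ s₁, and k * τ ≤ s₁ ≤ s₂ keeps the second
  -- parameter non-negative.
  obtain ⟨k, hk, hk', hd⟩ := exists_zpow_dist_le h s₁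
  refine ⟨ψ * g ^ k, mul_mem hψG (zpow_mem hgG k), s₂ - k * τ, by linarith, ?_, ?_⟩
  · have h3 := hd 0
    rw [zero_add, ← ψ.isometry.dist_eq] at h3
    have := dist_triangle (ψ ((g ^ k) (γ 0))) (ψ (γ s₁)) (η₁ 0)
    simp only [Function.comp_apply] at hd₁
    simp only [IsometryEquiv.coe_mul, Function.comp_apply]
    linarith
  · rw [IsometryEquiv.coe_mul, Function.comp_apply, zpow_apply_axis h.map, sub_add_cancel]
    exact hd₂

end TwoLines

/-- If a group acts transitively on the pairs of distinct points of the orbit of `b`, then there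
are translates of the axis that pass near the base point and then near a given orbit point. -/
theorem IsCAT0.exists_translate [ProperSpace X] (hX : IsCAT0 X) {G : Subgroup (X ≃ᵢ X)}
    {g : X ≃ᵢ X} (hgG : g ∈ G) {γ : ℝ → X} {B τ : ℝ} {a b : Boundary X}
    (h : IsTranslation g γ B τ a b) {O : Set (Boundary X)} (ha : ∀ f ∈ G, f • a ∈ O)
    (hb : ∀ f ∈ G, f • b ∈ O)
    (hO : ∀ x ∈ O, ∀ y ∈ O, x ≠ y → ∃ ψ ∈ G, ψ • a = x ∧ ψ • b = y)
    {f : X ≃ᵢ X} (hf : f ∈ G) :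
    ∃ ψ ∈ G, ∃ s, 0 ≤ s ∧ dist (ψ (γ 0)) (γ 0) ≤ 26 * B + τ ∧
      dist (ψ (γ s)) (f (γ 0)) ≤ 15 * B := by
  obtain ⟨P, hP⟩ := exists_isProjectionParam h.isometry
  have ha1 := ha 1 (one_mem G)
  have hb1 := hb 1 (one_mem G)
  rw [one_smul] at ha1 hb1
  have key : ∀ (η : ℝ → X) (Q : X → ℝ) (x : Boundary X), x ∈ O → Isometry η →
      IsProjectionParam η Q → IsContracting B (range η) → EndsAt (fun t => η (-t)) x →
      η 0 = γ 0 → 0 ≤ Q (f (γ 0)) → ∃ ψ ∈ G, ∃ s, 0 ≤ s ∧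
        dist (ψ (γ 0)) (γ 0) ≤ 26 * B + τ ∧ dist (ψ (γ s)) (f (γ 0)) ≤ 15 * B := by
    intro η Q x hxO hη hQ hA hx hη0 h0
    rw [← hη0]
    -- Reversing f ∘ γ if necessary gives the second sign condition; reversing γ below gives the
    -- first. The ends used may thus be translates of a or of b, so O must contain both kinds.
    by_cases hfr : ∀ N : ℝ, ∃ t, N ≤ t ∧ P (f.symm (η (-t))) ≤ 0
    · have := hX.exists_translate_of_two_lines hgG h (hO x hxO _ (hb f hf)) hη
        (f.isometry.comp h.isometry) hQ (hP.map f) hA (h.contracting.map f) h0 hfr hx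
        (h.right.smul f)
      simpa only [Function.comp_apply, hη0] using this
    · push Not at hfr
      obtain ⟨N₀, hN₀⟩ := hfr
      have := hX.exists_translate_of_two_lines hgG h (hO x hxO _ (ha f hf)) hη
        (f.isometry.comp (comp_neg_isometry h.isometry)) hQ (hP.neg.map f) hA
        (h.contracting.neg.map f) (by simpa using h0)
        (fun N => ⟨max N N₀, le_max_left _ _, by
          linarith [hN₀ (max N N₀) (le_max_right _ _)]⟩) hx (h.left.smul f)
      simpa only [Function.comp_apply, hη0, neg_zero] using this
  rcases le_total 0 (P (f (γ 0))) with h0 | h0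
  · exact key γ P a ha1 h.isometry hP h.contracting h.left rfl h0
  · exact key (fun t => γ (-t)) _ b hb1 (comp_neg_isometry h.isometry) hP.neg h.contracting.neg
      (by simpa using h.right) (by simp) (by linarith)

/-- A limit point is approximated by orbit points in the cone topology. -/
theorem exists_geodesic_of_mem_limitSet (hX : IsCAT0 X) {G : Subgroup (X ≃ᵢ X)} {ξ : Boundary X}
    (hξ : ξ ∈ limitSet G) : ∃ (x : X) (c : ℝ → X), EndsAt c ξ ∧ ∀ n : ℕ, ∃ f ∈ G, ∃ δ : ℝ → X,
      ∃ l : ℝ, n ≤ l ∧ IsGeodesicOn δ (Icc 0 l) ∧ δ 0 = c 0 ∧ δ l = f x ∧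
        ∀ t : ℝ, 0 ≤ t → t ≤ n → dist (δ t) (c t) ≤ 2 := by
  obtain ⟨x, hx⟩ := hξ
  induction ξ using Quotient.inductionOn with
  | h c =>
  have hc : IsGeodesicOn (fun t : ℝ => c.toFun t.toNNReal) (Ici 0) := fun s hs t ht => by
    rw [c.isometry'.dist_eq, NNReal.dist_eq, Real.coe_toNNReal _ hs, Real.coe_toNNReal _ ht]
  refine ⟨x, fun t => c.toFun t.toNNReal, ⟨hc, Quotient.sound ⟨0, fun t => by simp [rayOf]⟩⟩,
    fun n => ?_⟩
  rw [accPt_iff_nhds] at hx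
  -- Radius n + 1 because cone neighbourhoods need a positive radius, also for n = 0.
  have hopen : IsOpen (coneNhd c (n + 1) 1) :=
    TopologicalSpace.isOpen_generateFrom_of_mem (Or.inr ⟨c, n + 1, 1, by positivity, one_pos, rfl⟩)
  have hmem : Bordification.ideal c.endpoint ∈ coneNhd c (n + 1) 1 :=
    Or.inr ⟨c, rfl, rfl, by simp⟩
  obtain ⟨z, ⟨hz, f, hf, rfl⟩, -⟩ := hx _ (hopen.mem_nhds hmem)
  rcases hz with ⟨y, p, hy, hr, hp, hpy, hpc⟩ | ⟨c', hc', -⟩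
  · obtain rfl : f x = y := Bordification.inner.inj hy
    obtain ⟨δ, hδ, hδ0, hδp, hδl⟩ := hX.exists_geodesic_through (x := c.toFun 0) (p := p)
      (y := f x) (by rw [hp, hpy]; ring)
    push_cast at hr hp
    refine ⟨f, hf, δ, _, by linarith, hδ, by simpa using hδ0, hδl, fun t ht htn => ?_⟩
    have h1 := hX.fellow_travel (α := δ) (β := fun t : ℝ => c.toFun t.toNNReal) (a := n + 1)
      (b := n + 1) (C := 0) (D := 1) (t := t) (hδ.mono (Icc_subset_Icc le_rfl hr.le))
      (hc.mono Icc_subset_Ici_self) (by simp [hδ0])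
      (by
        rw [hp] at hδp
        rw [hδp]
        have : (n + 1 : ℝ).toNNReal = (n + 1 : ℝ≥0) := by
          rw [← NNReal.coe_inj, Real.coe_toNNReal _ (by positivity)]; push_cast; rfl
        rw [this]; exact hpc.le) ht (by linarith) (by linarith)
    linarith
  · exact absurd hc' (by simp)

/-- If a closed group acts transitively on the pairs of distinct points of the orbit of `b`, then
the limit set is contained in this orbit. -/
theorem IsCAT0.exists_smul_eq_of_mem_limitSet [ProperSpace X] (hX : IsCAT0 X)
    {G : Subgroup (X ≃ᵢ X)} (hG : IsClosed (G : Set (X ≃ᵢ X))) {g : X ≃ᵢ X} (hgG : g ∈ G)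
    {γ : ℝ → X} {B τ : ℝ} {a b : Boundary X}
    (h : IsTranslation g γ B τ a b) {O : Set (Boundary X)} (ha : ∀ f ∈ G, f • a ∈ O)
    (hb : ∀ f ∈ G, f • b ∈ O)
    (hO : ∀ x ∈ O, ∀ y ∈ O, x ≠ y → ∃ ψ ∈ G, ψ • a = x ∧ ψ • b = y)
    {ξ : Boundary X} (hξ : ξ ∈ limitSet G) : ∃ ψ ∈ G, ψ • b = ξ := by
  obtain ⟨x, c, hc, happ⟩ := exists_geodesic_of_mem_limitSet hX hξ
  choose f hfG δ l hnl hδ hδ0 hδl hδc using happ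
  choose ψ hψG s hs hψ0 hψs using fun n => hX.exists_translate hgG h ha hb hO (hfG n)
  have hB := h.pos_B
  have hτ := h.pos
  set C := 26 * B + τ + dist (γ 0) (c 0)
  set D := 15 * B + dist (γ 0) x
  have hCn : 0 ≤ C := by positivity
  have hDn : 0 ≤ D := by positivity
  have hfirst : ∀ n, dist (ψ n (γ 0)) (δ n 0) ≤ C := fun n => by
    rw [hδ0]
    exact (dist_triangle _ (γ 0) _).trans (add_le_add (hψ0 n) le_rfl)
  have hlast : ∀ n, dist (ψ n (γ (s n))) (δ n (l n)) ≤ D := fun n => by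
    rw [hδl]
    refine (dist_triangle _ (f n (γ 0)) _).trans (add_le_add (hψs n) ?_)
    rw [(f n).isometry.dist_eq]
  have hiso : ∀ n, Isometry fun t => ψ n (γ t) := fun n => (ψ n).isometry.comp h.isometry
  -- The pieces of the translated axes that follow δ n become arbitrarily long.
  have hsn : ∀ n, n - C - D ≤ s n := fun n => by
    have hl0 : 0 ≤ l n := n.cast_nonneg.trans (hnl n)
    have h1 := dist_triangle4 (δ n 0) (ψ n (γ 0)) (ψ n (γ (s n))) (δ n (l n))
    rw [(hδ n).dist_of_le ⟨le_rfl, hl0⟩ ⟨hl0, le_rfl⟩ hl0, (hiso n).dist_eq, Real.dist_eq,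
      zero_sub, abs_neg, abs_of_nonneg (hs n), dist_comm (δ n 0)] at h1
    linarith [hfirst n, hlast n, hnl n]
  have hev : ∀ t : ℝ, 0 ≤ t → ∀ᶠ n : ℕ in (Filter.hyperfilter ℕ : Filter ℕ),
      dist (ψ n (γ t)) (c t) ≤ 2 * (C + D) + 2 := fun t ht => by
    refine Filter.Eventually.filter_mono Nat.hyperfilter_le_atTop ?_
    filter_upwards [Filter.eventually_ge_atTop ⌈t + C + D⌉₊] with n hn
    have hn' := Nat.ceil_le.1 hn
    have h1 := hX.fellow_travel (.of_isometry (hiso n) _) (hδ n) (hfirst n) (hlast n) ht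
      (by linarith [hsn n]) (by linarith [hnl n])
    exact (dist_triangle _ (δ n t) _).trans
      (add_le_add h1 (hδc n t ht (by linarith)))
  obtain ⟨φ, hφG, hφ⟩ := exists_tendsto_mem hG (Filter.hyperfilter ℕ) hψG (x := γ 0)
    (Filter.Eventually.of_forall hψ0)
  exact ⟨φ, hφG, smul_eq_of_tendsto hφ h.right hc hev⟩

/-- A rank-one isometry or its inverse translates a contracting line from one of two given fixed
points to the other. -/
theorem IsCAT0.exists_isTranslation [ProperSpace X] (hX : IsCAT0 X) {G : Subgroup (X ≃ᵢ X)}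
    {g : X ≃ᵢ X} (hgG : g ∈ G) (hg : IsRankOne g) {a b : Boundary X} (hab : a ≠ b)
    (hga : g • a = a) (hgb : g • b = b) :
    ∃ f ∈ G, ∃ γ B τ, IsTranslation f γ B τ a b := by
  obtain ⟨-, B, hB, γ, ⟨hγ, τ, -, hτ, hgγ⟩, hA⟩ := hg
  -- If b is the backward end of the axis, the inverse of g and the reversed line are used.
  rcases hX.endsAt_or_of_fixed hγ hA hτ hgγ hgb with hb | hb <;>
    rcases hX.endsAt_or_of_fixed hγ hA hτ hgγ hga with ha | ha
  · exact absurd (ha.unique hb) hab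
  · exact ⟨g, hgG, γ, B, τ, hγ, hA, hB, hτ, hgγ, ha, hb⟩
  · refine ⟨g⁻¹, inv_mem hgG, fun t => γ (-t), B, τ, comp_neg_isometry hγ, hA.neg, hB, hτ,
      fun t => ?_, by simpa using ha, hb⟩
    have := hgγ (-(t + τ))
    rw [show -(t + τ) + τ = -t by ring] at this
    rw [← this]
    exact g.symm_apply_apply _
  · exact absurd (ha.unique hb) hab

end RankOne

theorem mainTheorem10 {X : Type*} [MetricSpace X] [ProperSpace X] (hX : RankOne.IsCAT0 X)
    (G : Subgroup (X ≃ᵢ X)) (hclosed : IsClosed (G : Set (X ≃ᵢ X)))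
    (hG : RankOne.IsNonelementary G)
    (g : X ≃ᵢ X) (hgG : g ∈ G) (hg : RankOne.IsRankOne g)
    (a b : RankOne.Boundary X) (ha : a ∈ RankOne.limitSet G) (hb : b ∈ RankOne.limitSet G)
    (hab : a ≠ b) (hga : g • a = a) (hgb : g • b = b)
    (htrans : ¬ ∀ p ∈ (RankOne.limitSet G).offDiag, ∀ q ∈ (RankOne.limitSet G).offDiag,
      ∃ u ∈ G, u • p = q) :
    ∃ h : G, IsCompact (MulAction.stabilizer G (b, h • b) : Set G) := by
  by_contra! hcon
  obtain ⟨f, hfG, γ, B, τ, hf⟩ := hX.exists_isTranslation hgG hg hab hga hgb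
  have h1 : ∀ h ∈ G, h • b ≠ b → ∃ φ ∈ G, φ • b = b ∧ φ • a = h • b := fun h hhG hne =>
    hX.exists_smul_eq_of_not_isCompact hclosed hfG hf hne (hcon ⟨h, hhG⟩)
  obtain ⟨k, hkG, hk⟩ : ∃ k ∈ G, k • b = a := by
    obtain ⟨h, hhG, hne⟩ : ∃ h ∈ G, h • b ≠ b := by
      by_contra! hfix
      exact hG.2 ⟨b, hfix⟩
    obtain ⟨φ, hφG, -, hφa⟩ := h1 h hhG hne
    exact ⟨φ⁻¹ * h, mul_mem (inv_mem hφG) hhG, by rw [mul_smul, ← hφa, inv_smul_smul]⟩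
  set O : Set (RankOne.Boundary X) := {x | ∃ h ∈ G, h • b = x}
  have hO : ∀ x ∈ O, ∀ y ∈ O, x ≠ y → ∃ ψ ∈ G, ψ • a = x ∧ ψ • b = y := by
    -- Applying h'⁻¹ reduces the pair (h • b, h' • b) to one with second point b.
    rintro _ ⟨h, hhG, rfl⟩ _ ⟨h', hhG', rfl⟩ hne
    obtain ⟨φ, hφG, hφb, hφa⟩ := h1 (h'⁻¹ * h) (mul_mem (inv_mem hhG') hhG) fun heq => by
      rw [mul_smul, inv_smul_eq_iff] at heq
      exact hne heq
    refine ⟨h' * φ, mul_mem hhG' hφG, ?_, by rw [mul_smul, hφb]⟩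
    rw [mul_smul, hφa, mul_smul, smul_inv_smul]
  have hlim : ∀ ξ ∈ RankOne.limitSet G, ξ ∈ O := fun ξ hξ =>
    hX.exists_smul_eq_of_mem_limitSet hclosed hfG hf (O := O)
      (fun u hu => ⟨u * k, mul_mem hu hkG, by rw [mul_smul, hk]⟩) (fun u hu => ⟨u, hu, rfl⟩) hO hξ
  refine htrans ?_
  rintro ⟨x, y⟩ ⟨hx, hy, hxy⟩ ⟨x', y'⟩ ⟨hx', hy', hxy'⟩
  obtain ⟨u, huG, hua, hub⟩ := hO x (hlim x hx) y (hlim y hy) hxy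
  obtain ⟨v, hvG, hva, hvb⟩ := hO x' (hlim x' hx') y' (hlim y' hy') hxy'
  refine ⟨v * u⁻¹, mul_mem hvG (inv_mem huG), ?_⟩
  rw [Prod.smul_mk, mul_smul, mul_smul, ← hua, ← hub, inv_smul_smul, inv_smul_smul, hva, hvb]
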